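/- **Setting.** All inputs and outputs are scalar and real. $\mathcal L_{2e}$ is the set of measurable $u:[0,\infty)\to\mathbb R$ that are square integrable on every $[0,T]$; $\|u\|^2_{\mathcal L_2}=\int_0^\infty|u|^2\,dt\in[0,\infty]$ and $\|u\|^2_{[0,T]}=\int_0^T|u|^2\,dt$. $\mathcal{RH}_\infty$ is the set of proper real rational functions with all poles in $\operatorname{Re}s<0$. For a real rational function $G$, $\|G\|_{\mathcal H_\infty}=\sup\{|G(s)|:\operatorname{Re}s>0,\ s\text{ not a pole of }G\}\in[0,\infty]$. Let $\Sigma$ be the system $\dot x=Ax+Ba$, $y_r=C_rx+D_ra$, $y_p=C_px+D_pa$ with $(A,B)$ controllable, and let $$\gamma^*=\sup\{\|y_p\|^2_{\mathcal L_2}: a\in\mathcal L_{2e},\ x(0)=0,\ \|y_r\|^2_{\mathcal L_2}\le 1\}$$ be its output-to-output gain. Let $\tilde\Sigma$ be the system $\dot x=\tilde Ax+B_dd+B_ff$, $r=Cx+D_dd+D_ff$ with $(\tilde A,C)$ observable, let $T_{fr}[f]$, $T_{dr}[d]$ be the responses of $r$ to $f$ alone and to $d$ alone with zero initial state, and let $$\tilde\gamma^*=\sup\{\|f\|^2_{\mathcal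 L_2}: f,\tilde d\in\mathcal L_{2e},\ T_{fr}[f]=T_{dr}[\tilde d],\ \|\tilde d\|^2_{\mathcal L_2}\le 4\}$$ be its reformulated input-to-input gain. The transfer functions of these systems are denoted by $T_{ay_r},T_{ay_p},T_{fr},T_{dr}$. Let $T_{ay_r}=N_rM_O^{-1}$, $T_{ay_p}=N_pM_O^{-1}$ be a right and $T_{fr}=M_I^{-1}N_f$, $T_{dr}=M_I^{-1}N_d$ a left co-prime factorization over $\mathcal{RH}_\infty$; that is, all factors are stable (in $\mathcal{RH}_\infty$), $M_O,M_I\neq0$, and $XM_O+Y_rN_r+Y_pN_p=1$, $M_I\tilde X+N_fY_f+N_dY_d=1$ for some $X,Y_r,Y_p,\tilde X,Y_f,Y_d\in\mathcal{RH}_\infty$. Suppose $N_r\ne0$ and $N_f\neq 0$. **Theorem.** $$\gamma^*\ \ge\ \Big\|\frac{N_p}{N_r}\Big\|^2_{\mathcal H_\infty}\qquad\text{and}\qquad \tilde\gamma^*\ \ge\ 4\Big\|\frac{N_d}{N_f}\Big\|^2_{\mathcal H_\infty}.$$ Furthermore, equality holds over periodic trajectories, provided that zeros of $N_r$ and $N_f$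 in $\operatorname{Re}s>0$, if any, cancel in the ratios: 1. If $N_p/N_r$ has no pole in $\operatorname{Re}s>0$ (for instance, if $N_r$ has no zero there), then $\|N_p/N_r\|^2_{\mathcal H_\infty}$ is equal to the supremum of $\|y_p\|^2_{[0,T]}$ over all $T>0$ and all $T$-periodic trajectories $(a,x)$ of $\Sigma$ with $a\in\mathcal L_{2e}$ and $\|y_r\|^2_{[0,T]}\le1$, both when $x(0)=0$ is required and when $x(0)$ is arbitrary. 2. If $N_d/N_f$ has no pole in $\operatorname{Re}s>0$ (for instance, if $N_f$ has no zero there), then $4\|N_d/N_f\|^2_{\mathcal H_\infty}$ is equal to the supremum of $\|f\|^2_{[0,T]}$ over all $T>0$ and all pairs of $T$-periodic trajectories, $(f,x_f)$ of $\dot x=\tilde Ax+B_ff$ and $(\tilde d,x_d)$ of $\dot x=\tilde Ax+B_d\tilde d$, with $f,\tilde d\in\mathcal L_{2e}$, $x_f(0)=x_d(0)=0$, equal outputs $Cx_f+D_ff=Cx_d+D_d\tilde d$ almost everywhere, and $\|\tilde d\|^2_{[0,T]}\le4$. If moreover $N_f$ and $N_d$ have no common zero on the imaginary axis, the same supremum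 is obtained when $x_f(0)$ and $x_d(0)$ are allowed to be any states reachable from $0$ in the respective systems. -/

import Mathlib

open MeasureTheory Polynomial
open scoped ENNReal Matrix

noncomputable section

/-! ### Signals on `[0, ∞)` -/

/-- The extended space `L₂ₑ`: measurable signals, square integrable on every `[0, T]`. -/
def IsL2e (u : ℝ → ℝ) : Prop :=
  ∀ T : ℝ, 0 < T → MemLp u 2 (volume.restrict (Set.Icc 0 T))

/-- The squared `L₂` norm (energy) of a signal over `[0, ∞)`, possibly `∞`. -/
def energy (u : ℝ → ℝ) : ℝ≥0∞ := ∫⁻ t in Set.Ici (0 : ℝ), ‖u t‖ₑ ^ 2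

/-- The squared `L₂` norm (energy) of a signal over `[0, T]`. -/
def energyOn (T : ℝ) (u : ℝ → ℝ) : ℝ≥0∞ := ∫⁻ t in Set.Icc (0 : ℝ) T, ‖u t‖ₑ ^ 2

/-! ### State-space systems with scalar inputs and outputs -/

/-- `(u, x)` is an input/state trajectory of `x' = A x + B u` on `[0, ∞)` with `u ∈ L₂ₑ`
(solution in the sense of Carathéodory, i.e. of the integrated equation). -/
def IsTrajectory {n : ℕ} (A : Matrix (Fin n) (Fin n) ℝ) (B : Fin n → ℝ)
    (u : ℝ → ℝ) (x : ℝ → Fin n → ℝ) : Prop :=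
  IsL2e u ∧ ContinuousOn x (Set.Ici 0) ∧
    ∀ t : ℝ, 0 ≤ t → x t = x 0 + ∫ τ in (0 : ℝ)..t, (A *ᵥ x τ + u τ • B)

/-- `T`-periodic input/state trajectories on `[0, ∞)`, with period `T > 0`. -/
def IsPeriodicTrajectory {n : ℕ} (A : Matrix (Fin n) (Fin n) ℝ) (B : Fin n → ℝ)
    (T : ℝ) (u : ℝ → ℝ) (x : ℝ → Fin n → ℝ) : Prop :=
  0 < T ∧ IsTrajectory A B u x ∧
    ∀ t : ℝ, 0 ≤ t → x (t + T) = x t ∧ u (t + T) = u t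

/-- The output `y = C x + D u`. -/
def output {n : ℕ} (C : Fin n → ℝ) (D : ℝ) (u : ℝ → ℝ) (x : ℝ → Fin n → ℝ) : ℝ → ℝ :=
  fun t => C ⬝ᵥ x t + D * u t

/-- The states reachable from the origin: the span of `B, A B, A² B, …`. -/
def reachable {n : ℕ} (A : Matrix (Fin n) (Fin n) ℝ) (B : Fin n → ℝ) :
    Submodule ℝ (Fin n → ℝ) :=
  Submodule.span ℝ (Set.range fun k : ℕ => (A ^ k) *ᵥ B)

def IsControllable {n : ℕ} (A : Matrix (Fin n) (Fin n) ℝ) (B : Fin n → ℝ) : Prop :=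
  reachable A B = ⊤

def IsObservable {n : ℕ} (A : Matrix (Fin n) (Fin n) ℝ) (C : Fin n → ℝ) : Prop :=
  ∀ x : Fin n → ℝ, (∀ k : ℕ, C ⬝ᵥ ((A ^ k) *ᵥ x) = 0) → x = 0

/-- The transfer function `C (s I - A)⁻¹ B + D`, as a real rational function of `s`. -/
def transferFunction {n : ℕ} (A : Matrix (Fin n) (Fin n) ℝ) (B C : Fin n → ℝ) (D : ℝ) :
    RatFunc ℝ :=
  (fun i => RatFunc.C (C i)) ⬝ᵥ
      ((Matrix.scalar (Fin n) (RatFunc.X : RatFunc ℝ) - A.map RatFunc.C)⁻¹ *ᵥ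
        fun i => RatFunc.C (B i)) +
    RatFunc.C D

/-- The system `x' = A x + B a`, `y_r = C_r x + D_r a`, `y_p = C_p x + D_p a`. -/
structure AttackSystem (n : ℕ) where
  A : Matrix (Fin n) (Fin n) ℝ
  B : Fin n → ℝ
  Cr : Fin n → ℝ
  Dr : ℝ
  Cp : Fin n → ℝ
  Dp : ℝ

/-- The system `x' = A x + B_d d + B_f f`, `r = C x + D_d d + D_f f`. -/
structure FaultSystem (n : ℕ) where
  A : Matrix (Fin n) (Fin n) ℝ
  Bd : Fin n → ℝ
  Bf : Fin n → ℝ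
  C : Fin n → ℝ
  Dd : ℝ
  Df : ℝ

namespace AttackSystem

variable {n : ℕ} (S : AttackSystem n)

/-- The transfer function from `a` to `y_r`. -/
def Tr : RatFunc ℝ := transferFunction S.A S.B S.Cr S.Dr

/-- The transfer function from `a` to `y_p`. -/
def Tp : RatFunc ℝ := transferFunction S.A S.B S.Cp S.Dp

/-- The output-to-output gain: the supremum of the energy of `y_p` over all `a ∈ L₂ₑ` and
`x(0) = 0` such that the energy of `y_r` is at most `1`. -/
def oog : ℝ≥0∞ :=
  sSup {e | ∃ (a : ℝ → ℝ) (x : ℝ → Fin n → ℝ), IsTrajectory S.A S.B a x ∧ x 0 = 0 ∧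
    energy (output S.Cr S.Dr a x) ≤ 1 ∧ e = energy (output S.Cp S.Dp a x)}

/-- The output-to-output gain over periodic trajectories (of arbitrary period) with initial state
in `X₀`, energies being taken over one period. -/
def periodicOog (X₀ : Set (Fin n → ℝ)) : ℝ≥0∞ :=
  sSup {e | ∃ (T : ℝ) (a : ℝ → ℝ) (x : ℝ → Fin n → ℝ),
    IsPeriodicTrajectory S.A S.B T a x ∧ x 0 ∈ X₀ ∧
    energyOn T (output S.Cr S.Dr a x) ≤ 1 ∧ e = energyOn T (output S.Cp S.Dp a x)}

end AttackSystem

namespace FaultSystem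

variable {n : ℕ} (S : FaultSystem n)

/-- The transfer function from `f` to `r`. -/
def Tf : RatFunc ℝ := transferFunction S.A S.Bf S.C S.Df

/-- The transfer function from `d` to `r`. -/
def Td : RatFunc ℝ := transferFunction S.A S.Bd S.C S.Dd

/-- The reformulated input-to-input gain: the supremum of the energy of `f` over all
`f, d ∈ L₂ₑ` such that the responses of `r` to `f` alone and to `d` alone, both with zero initial
state, coincide and the energy of `d` is at most `4`. -/
def iig : ℝ≥0∞ :=
  sSup {e | ∃ (f d : ℝ → ℝ) (xf xd : ℝ → Fin n → ℝ),
    IsTrajectory S.A S.Bf f xf ∧ xf 0 = 0 ∧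
    IsTrajectory S.A S.Bd d xd ∧ xd 0 = 0 ∧
    (∀ᵐ t ∂volume.restrict (Set.Ici (0 : ℝ)),
      output S.C S.Df f xf t = output S.C S.Dd d xd t) ∧
    energy d ≤ 4 ∧ e = energy f}

/-- The reformulated input-to-input gain over periodic trajectories (of arbitrary common period),
with initial states in `Xf` (response to `f`) and `Xd` (response to `d`), energies being taken
over one period. -/
def periodicIig (Xf Xd : Set (Fin n → ℝ)) : ℝ≥0∞ :=
  sSup {e | ∃ (T : ℝ) (f d : ℝ → ℝ) (xf xd : ℝ → Fin n → ℝ),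
    IsPeriodicTrajectory S.A S.Bf T f xf ∧ xf 0 ∈ Xf ∧
    IsPeriodicTrajectory S.A S.Bd T d xd ∧ xd 0 ∈ Xd ∧
    (∀ᵐ t ∂volume.restrict (Set.Ici (0 : ℝ)),
      output S.C S.Df f xf t = output S.C S.Dd d xd t) ∧
    energyOn T d ≤ 4 ∧ e = energyOn T f}

end FaultSystem

/-! ### Rational transfer functions -/

/-- `s` is a pole of `G`. -/
def IsPole (G : RatFunc ℝ) (s : ℂ) : Prop := aeval s G.denom = 0

/-- `s` is a zero of `G`. -/
def IsZero (G : RatFunc ℝ) (s : ℂ) : Prop := aeval s G.num = 0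

/-- `G ∈ RH∞`: `G` is proper and stable (all its poles lie in the open left half-plane). -/
def IsRHInf (G : RatFunc ℝ) : Prop :=
  G.num.natDegree ≤ G.denom.natDegree ∧ ∀ s : ℂ, IsPole G s → s.re < 0

/-- The `H∞` norm: the supremum of `|G(s)|` over the open right half-plane, poles left out.
It is `∞` if `G` is improper or has a pole in the closed right half-plane. -/
def hInfNorm (G : RatFunc ℝ) : ℝ≥0∞ :=
  sSup {e | ∃ s : ℂ, 0 < s.re ∧ ¬ IsPole G s ∧ e = ‖G.eval (algebraMap ℝ ℂ) s‖ₑ}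

/-- `T₁ = N₁ M⁻¹`, `T₂ = N₂ M⁻¹` is a right co-prime factorization over `RH∞` of the column
`(T₁, T₂)`: the factors are in `RH∞` and the column `(M, N₁, N₂)` has a left inverse over
`RH∞`. -/
def IsRightCoprimeFactorization (T₁ T₂ N₁ N₂ M : RatFunc ℝ) : Prop :=
  IsRHInf N₁ ∧ IsRHInf N₂ ∧ IsRHInf M ∧ M ≠ 0 ∧ T₁ = N₁ * M⁻¹ ∧ T₂ = N₂ * M⁻¹ ∧
    ∃ X Y₁ Y₂ : RatFunc ℝ, IsRHInf X ∧ IsRHInf Y₁ ∧ IsRHInf Y₂ ∧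
      X * M + Y₁ * N₁ + Y₂ * N₂ = 1

/-- `T₁ = M⁻¹ N₁`, `T₂ = M⁻¹ N₂` is a left co-prime factorization over `RH∞` of the row
`(T₁, T₂)`: the factors are in `RH∞` and the row `(M, N₁, N₂)` has a right inverse over
`RH∞`. -/
def IsLeftCoprimeFactorization (T₁ T₂ N₁ N₂ M : RatFunc ℝ) : Prop :=
  IsRHInf N₁ ∧ IsRHInf N₂ ∧ IsRHInf M ∧ M ≠ 0 ∧ T₁ = M⁻¹ * N₁ ∧ T₂ = M⁻¹ * N₂ ∧
    ∃ X Y₁ Y₂ : RatFunc ℝ, IsRHInf X ∧ IsRHInf Y₁ ∧ IsRHInf Y₂ ∧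
      M * X + N₁ * Y₁ + N₂ * Y₂ = 1

end

/-! The common denominator cancels in both ratios: `Np / Nr` is a quotient `numP / numR` of
polynomials, and `Nd / Nf` equals `numD / numF`. For a smooth scalar signal `z`, the input `χ(d/dt)
z` and state `adj(d/dt - A) B z`, with `χ` the characteristic polynomial, form a trajectory whose
outputs are `numR(d/dt) z` and `numP(d/dt) z`. In the fault problem, `f = χ numD (d/dt) z` and `d =
χ numF (d/dt) z` produce the same residual. Trajectories are thus built by choosing `z`.

Lower bounds. Without a pole in the open right half-plane, Phragmén–Lindelöf reduces the norm to
values on the imaginary axis (`hInfNorm_le_of_imaginary_axis`). At a frequency `w ≠ 0`, take for `z`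
a real part of `κ exp(iwt)` times a window of width `T`, with `T` a multiple of `2π/|w|`. As `T`
grows, derivatives of the window become negligible and the energy ratio tends to `|P(iw)|² /
|Q(iw)|²` (`exists_periodic_signal`). The window vanishes near multiples of `T`, so the trajectory
is periodic, starts at rest, and may be cut off after one period. At a pole `s` of the ratio with
`Re s > 0`, signals like `t^l exp(st)` are annihilated by `Q(d/dt)` but not by `P(d/dt)`, so the
gain is infinite (`exists_unbounded_signal`).

Upper bounds. Fourier coefficients of a periodic trajectory satisfy `(iw - A) x = u B`. Such a
solution with reachable `x` extends to polynomials in the frequency variable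
(`exists_polynomial_solution`), so the transfer relations survive even at an eigenvalue of `A`. They
bound the coefficients of one signal by those of the other, and Parseval compares the energies
(`energyOn_le_of_norm_finiteLaplace_le`). -/

noncomputable section

/-! ### Polynomial descriptions of state-space systems -/

section Algebra

variable {n : ℕ} {A : Matrix (Fin n) (Fin n) ℝ} {B : Fin n → ℝ}

/-- The polynomial vector `adj (X - A) B`. -/
def resolventNum (A : Matrix (Fin n) (Fin n) ℝ) (B : Fin n → ℝ) : Fin n → ℝ[X] :=
  A.charmatrix.adjugate *ᵥ fun i => C (B i)

/-- The numerator of the transfer function over the denominator `det (X - A)`. -/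
def transferNum (A : Matrix (Fin n) (Fin n) ℝ) (B c : Fin n → ℝ) (D : ℝ) : ℝ[X] :=
  (fun i => C (c i)) ⬝ᵥ resolventNum A B + C D * A.charpoly

theorem charmatrix_mulVec_apply {R : Type*} [CommRing R] (A : Matrix (Fin n) (Fin n) R)
    (v : Fin n → R[X]) (i : Fin n) :
    (A.charmatrix *ᵥ v) i = X * v i - ∑ j, C (A i j) * v j := by
  rw [Matrix.charmatrix, Matrix.sub_mulVec, Pi.sub_apply]
  congr 1
  simp [Matrix.mulVec_diagonal]

theorem X_mul_resolventNum (A : Matrix (Fin n) (Fin n) ℝ) (B : Fin n → ℝ) (i : Fin n) :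
    X * resolventNum A B i =
      ∑ j, C (A i j) * resolventNum A B j + A.charpoly * C (B i) := by
  have h : (A.charmatrix *ᵥ resolventNum A B) i = A.charpoly * C (B i) := by
    rw [resolventNum, Matrix.mulVec_mulVec, Matrix.mul_adjugate, Matrix.smul_mulVec,
      Matrix.one_mulVec]
    rfl
  rw [charmatrix_mulVec_apply] at h
  linear_combination h

theorem map_resolventNum (A : Matrix (Fin n) (Fin n) ℝ) (B : Fin n → ℝ) (i : Fin n) :
    (resolventNum A B i).map (algebraMap ℝ ℂ) =
      ((A.map (algebraMap ℝ ℂ)).charmatrix.adjugate *ᵥ fun i => C (algebraMap ℝ ℂ (B i))) i := by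
  have h := RingHom.map_adjugate (mapRingHom (algebraMap ℝ ℂ)) A.charmatrix
  rw [Matrix.charmatrix_map]
  change _ = (((mapRingHom (algebraMap ℝ ℂ)).mapMatrix A.charmatrix).adjugate *ᵥ _) i
  have hB : (fun i => C (algebraMap ℝ ℂ (B i))) =
      mapRingHom (algebraMap ℝ ℂ) ∘ fun i => C (B i) := by
    ext1 j
    simp
  rw [← h, resolventNum, ← coe_mapRingHom, RingHom.map_mulVec, hB]
  rfl

theorem charpoly_mul_eq_mul_resolventNum {h : ℂ[X]} {v : Fin n → ℂ[X]}
    (hv : ∀ i, X * v i = ∑ j, C (algebraMap ℝ ℂ (A i j)) * v j + h * C (algebraMap ℝ ℂ (B i)))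
    (i : Fin n) :
    A.charpoly.map (algebraMap ℝ ℂ) * v i =
      h * (resolventNum A B i).map (algebraMap ℝ ℂ) := by
  set A' := A.map (algebraMap ℝ ℂ)
  have h1 : A'.charmatrix *ᵥ v = h • fun i => C (algebraMap ℝ ℂ (B i)) := by
    ext1 i
    rw [charmatrix_mulVec_apply, hv i]
    simp [A']
  have h2 := congrArg (fun w => (A'.charmatrix.adjugate *ᵥ w) i) h1
  simp only [Matrix.mulVec_mulVec, Matrix.adjugate_mul, Matrix.smul_mulVec, Matrix.one_mulVec,
    Matrix.mulVec_smul, Pi.smul_apply, smul_eq_mul] at h2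
  rw [map_resolventNum, ← h2, ← Matrix.charpoly_map]
  rfl

/-- Modulo the image of `X - A`, multiplication by `A` is multiplication by `X`, so `A ^ k B` is
congruent to `X ^ k B`. By linearity every reachable vector is congruent to a polynomial multiple of
`B`. -/
theorem exists_charmatrix_eq_of_mem_reachable {x : Fin n → ℝ} (hx : x ∈ reachable A B) :
    ∃ (q : ℝ[X]) (W : Fin n → ℝ[X]), ∀ i,
      X * W i = ∑ j, C (A i j) * W j + q * C (B i) - C (x i) := by
  induction hx using Submodule.span_induction with
  | mem x hx =>
    obtain ⟨k, rfl⟩ := hx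
    induction k with
    | zero => exact ⟨1, 0, fun i => by simp⟩
    | succ k ih =>
      obtain ⟨q, W, hW⟩ := ih
      refine ⟨X * q, fun i => X * W i + C (((A ^ k) *ᵥ B) i), fun i => ?_⟩
      have h1 : ((A ^ (k + 1)) *ᵥ B) i = ∑ j, A i j * ((A ^ k) *ᵥ B) j := by
        rw [pow_succ', ← Matrix.mulVec_mulVec]
        rfl
      have h2 : ∑ j, C (A i j) * (X * W j + C (((A ^ k) *ᵥ B) j)) =
          X * ∑ j, C (A i j) * W j + ∑ j, C (A i j) * C (((A ^ k) *ᵥ B) j) := by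
        rw [Finset.mul_sum, ← Finset.sum_add_distrib]
        exact Finset.sum_congr rfl fun j _ => by ring
      simp only [h1, h2, map_sum, map_mul]
      linear_combination X * hW i
  | zero => exact ⟨0, 0, fun i => by simp⟩
  | add x y _ _ hx hy =>
    obtain ⟨q, W, hW⟩ := hx
    obtain ⟨r, V, hV⟩ := hy
    refine ⟨q + r, W + V, fun i => ?_⟩
    simp only [Pi.add_apply, mul_add, Finset.sum_add_distrib, map_add]
    linear_combination hW i + hV i
  | smul a x _ hx =>
    obtain ⟨q, W, hW⟩ := hx
    refine ⟨C a * q, fun i => C a * W i, fun i => ?_⟩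
    have h2 : ∑ j, C (A i j) * (C a * W j) = C a * ∑ j, C (A i j) * W j := by
      rw [Finset.mul_sum]
      exact Finset.sum_congr rfl fun j _ => by ring
    simp only [Pi.smul_apply, smul_eq_mul, map_mul, h2]
    linear_combination C a * hW i

/-- A solution `(x, f)` of `(s - A) x = f B` with reachable `x` extends to a polynomial solution
of `(X - A) v = h B`; the corresponding outputs are polynomial multiples of the transfer
functions. -/
theorem exists_polynomial_solution {s f : ℂ} {x : Fin n → ℂ}
    (hre : (fun i => (x i).re) ∈ reachable A B) (him : (fun i => (x i).im) ∈ reachable A B)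
    (hx : ∀ i, s * x i = ∑ j, (A i j : ℂ) * x j + f * (B i : ℂ)) :
    ∃ h : ℂ[X], h.eval s = f ∧ ∀ (c : Fin n → ℝ) (D : ℝ), ∃ N : ℂ[X],
      N.eval s = ∑ i, (c i : ℂ) * x i + D * f ∧
      A.charpoly.map (algebraMap ℝ ℂ) * N = h * (transferNum A B c D).map (algebraMap ℝ ℂ) := by
  obtain ⟨q, W, hW⟩ := exists_charmatrix_eq_of_mem_reachable hre
  obtain ⟨r, V, hV⟩ := exists_charmatrix_eq_of_mem_reachable him
  set φ := algebraMap ℝ ℂ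
  let Q : ℂ[X] := q.map φ + C Complex.I * r.map φ
  let U : Fin n → ℂ[X] := fun i => (W i).map φ + C Complex.I * (V i).map φ
  have hU : ∀ i, X * U i = ∑ j, C (φ (A i j)) * U j + Q * C (φ (B i)) - C (x i) := by
    intro i
    have h1 := congrArg (Polynomial.map φ) (hW i)
    have h2 := congrArg (Polynomial.map φ) (hV i)
    simp only [Polynomial.map_mul, map_X, Polynomial.map_add, Polynomial.map_sub,
      Polynomial.map_sum, map_C] at h1 h2
    have h3 : C (x i) = C (φ (x i).re) + C Complex.I * C (φ (x i).im) := by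
      rw [← C_mul, ← C_add]
      congr 1
      rw [mul_comm]
      exact (Complex.re_add_im (x i)).symm
    have h4 : ∑ j, C (φ (A i j)) * U j = ∑ j, C (φ (A i j)) * (W j).map φ +
        C Complex.I * ∑ j, C (φ (A i j)) * (V j).map φ := by
      rw [Finset.mul_sum, ← Finset.sum_add_distrib]
      exact Finset.sum_congr rfl fun j _ => by simp only [U]; ring
    rw [h3, h4]
    simp only [U, Q]
    linear_combination h1 + C Complex.I * h2
  -- Since `(X - A) U = Q B - x` and `(X - A) x = (X - s) x + f B`, the terms in `(X - s) x` cancel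
  -- and `(X - A) v = h B`; at `X = s` the pair `(v, h)` is `(x, f)`.
  let v : Fin n → ℂ[X] := fun i => (X - C s) * U i + C (x i)
  let h : ℂ[X] := (X - C s) * Q + C f
  have hv : ∀ i, X * v i = ∑ j, C (φ (A i j)) * v j + h * C (φ (B i)) := by
    intro i
    have h1 := congrArg C (hx i)
    simp only [map_add, map_mul, map_sum] at h1
    have h4 : ∑ j, C (φ (A i j)) * v j = (X - C s) * ∑ j, C (φ (A i j)) * U j +
        ∑ j, C (φ (A i j)) * C (x j) := by
      rw [Finset.mul_sum, ← Finset.sum_add_distrib]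
      exact Finset.sum_congr rfl fun j _ => by simp only [v]; ring
    rw [h4]
    simp only [v, h]
    change C s * C (x i) = ∑ j, C (φ (A i j)) * C (x j) + C f * C (φ (B i)) at h1
    linear_combination (X - C s) * hU i + h1
  have key := charpoly_mul_eq_mul_resolventNum hv
  refine ⟨h, by simp [h], fun c D => ⟨∑ i, C (φ (c i)) * v i + C (φ D) * h, ?_, ?_⟩⟩
  · simp [eval_finsetSum, v, h, φ]
  · rw [transferNum, mul_add, Finset.mul_sum]
    simp only [Polynomial.map_add, dotProduct, Polynomial.map_sum, Polynomial.map_mul, map_C,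
      mul_add, Finset.mul_sum]
    congr 1
    · exact Finset.sum_congr rfl fun i _ => by linear_combination C (φ (c i)) * key i
    · ring

theorem transferFunction_eq (A : Matrix (Fin n) (Fin n) ℝ) (B c : Fin n → ℝ) (D : ℝ) :
    transferFunction A B c D =
      algebraMap ℝ[X] (RatFunc ℝ) (transferNum A B c D) /
        algebraMap ℝ[X] (RatFunc ℝ) A.charpoly := by
  set φ := algebraMap ℝ[X] (RatFunc ℝ)
  have hχ : φ A.charpoly ≠ 0 := by
    simpa [φ] using A.charpoly_monic.ne_zero
  have hM : Matrix.scalar (Fin n) (RatFunc.X : RatFunc ℝ) - A.map RatFunc.C =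
      φ.mapMatrix A.charmatrix := by
    ext i j
    by_cases hij : i = j
    · subst hij
      simp [φ, RatFunc.algebraMap_X, RatFunc.algebraMap_C, Matrix.charmatrix_apply_eq]
    · simp [hij, φ, RatFunc.algebraMap_C, Matrix.charmatrix_apply_ne]
  rw [transferFunction, hM, Matrix.inv_def, ← RingHom.map_adjugate, ← RingHom.map_det,
    Ring.inverse_eq_inv', eq_div_iff hχ, transferNum, map_add, add_mul, map_mul]
  congr 1
  · have h2 : (fun i => RatFunc.C (B i)) = φ ∘ fun i => C (B i) := by
      ext1 i; simp [φ, RatFunc.algebraMap_C]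
    have h3 : (fun i => RatFunc.C (c i)) = φ ∘ fun i => C (c i) := by
      ext1 i; simp [φ, RatFunc.algebraMap_C]
    rw [Matrix.smul_mulVec, dotProduct_smul, h2, h3, RingHom.map_dotProduct, resolventNum]
    have h4 : φ.mapMatrix A.charmatrix.adjugate *ᵥ (φ ∘ fun i => C (B i)) =
        φ ∘ (A.charmatrix.adjugate *ᵥ fun i => C (B i)) := by
      ext1 i
      rw [Function.comp, RingHom.map_mulVec]
      rfl
    rw [h4, smul_eq_mul, mul_comm, ← mul_assoc]
    change φ A.charpoly * (φ A.charpoly)⁻¹ * _ = _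
    rw [mul_inv_cancel₀ hχ, one_mul]

end Algebra

/-! ### The `H∞` norm of a real rational function -/

section HInf

open Filter Topology

theorem finite_setOf_aeval_line_eq_zero {q : ℝ[X]} (hq : q ≠ 0) (s : ℂ) {d : ℂ} (hd : d ≠ 0) :
    {t : ℝ | aeval (s + t * d) q = 0}.Finite := by
  have h : Function.Injective fun t : ℝ => s + t * d := fun a b hab => by
    simpa [hd] using hab
  refine ((q.rootSet_finite ℂ).preimage h.injOn).subset fun t ht => ?_
  exact (mem_rootSet.2 ⟨hq, ht⟩ : s + t * d ∈ q.rootSet ℂ)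

theorem le_of_forall_notMem_finite {f g : ℝ → ℝ} (hf : Continuous f) (hg : Continuous g)
    {S : Set ℝ} (hS : S.Finite) (h : ∀ t, t ∉ S → f t ≤ g t) (t : ℝ) : f t ≤ g t := by
  have hd : Dense Sᶜ := hS.countable.dense_compl ℝ
  have hc : IsClosed {t | f t ≤ g t} := isClosed_le hf hg
  exact (hc.closure_subset_iff.2 fun t ht => h t ht) (hd t)

theorem continuous_aeval_comp {X : Type*} [TopologicalSpace X] (p : ℝ[X]) {f : X → ℂ}
    (hf : Continuous f) : Continuous fun x => aeval (f x) p :=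
  p.continuous_aeval.comp hf

section

variable {P Q : ℝ[X]} {G : RatFunc ℝ}

theorem num_mul_eq_mul_denom (hQ : Q ≠ 0)
    (hG : G = algebraMap ℝ[X] (RatFunc ℝ) P / algebraMap ℝ[X] (RatFunc ℝ) Q) :
    G.num * Q = P * G.denom := by
  rw [hG]
  exact (RatFunc.num_mul_eq_mul_denom_iff hQ).2 rfl

theorem RatFunc.not_isZero_of_isPole {s : ℂ} (h : IsPole G s) : ¬ IsZero G s := by
  intro h0
  obtain ⟨a, b, hab⟩ := G.isCoprime_num_denom
  have := congrArg (aeval s) hab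
  unfold IsPole at h
  unfold IsZero at h0
  simp [h, h0] at this

/-- The bound holds off the poles in the open half-plane; letting `s + ε → s` from the right reaches
the axis and the excluded points. The product form stays meaningful at zeros of `Q`. -/
theorem norm_aeval_le_of_hInfNorm_le (hQ : Q ≠ 0)
    (hG : G = algebraMap ℝ[X] (RatFunc ℝ) P / algebraMap ℝ[X] (RatFunc ℝ) Q)
    {g : ℝ} (hg : 0 ≤ g) (hGg : hInfNorm G ≤ ENNReal.ofReal g) {s : ℂ} (hs : 0 ≤ s.re) :
    ‖aeval s P‖ ≤ g * ‖aeval s Q‖ := by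
  have hnum := num_mul_eq_mul_denom hQ hG
  have key : ∀ z : ℂ, 0 < z.re → aeval z G.denom ≠ 0 → ‖aeval z P‖ ≤ g * ‖aeval z Q‖ := by
    intro z hz hd
    have h1 : ‖G.eval (algebraMap ℝ ℂ) z‖ ≤ g := by
      have : ‖G.eval (algebraMap ℝ ℂ) z‖ₑ ≤ hInfNorm G := le_sSup ⟨z, hz, hd, rfl⟩
      replace this := this.trans hGg
      rwa [← ofReal_norm, ENNReal.ofReal_le_ofReal_iff hg] at this
    have hd' : 0 < ‖aeval z G.denom‖ := norm_pos_iff.2 hd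
    have h2 : ‖aeval z G.num‖ ≤ g * ‖aeval z G.denom‖ := by
      rw [RatFunc.eval, norm_div] at h1
      exact (div_le_iff₀ hd').1 h1
    have h3 := congrArg (fun p => ‖aeval z p‖) hnum
    simp only [map_mul, norm_mul] at h3
    refine le_of_mul_le_mul_right ?_ hd'
    rw [← h3]
    nlinarith [norm_nonneg (aeval z Q)]
  have hfin := finite_setOf_aeval_line_eq_zero G.denom_ne_zero s one_ne_zero
  have hev : ∀ᶠ ε : ℝ in 𝓝[>] 0, ‖aeval (s + ε * 1) P‖ ≤ g * ‖aeval (s + ε * 1) Q‖ := by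
    have h1 : ∀ᶠ ε : ℝ in 𝓝[>] 0,
        ε ∉ {t : ℝ | aeval (s + t * 1) G.denom = 0} \ {0} :=
      nhdsWithin_le_nhds ((hfin.subset Set.sdiff_subset).isClosed.isOpen_compl.mem_nhds (by simp))
    filter_upwards [h1, self_mem_nhdsWithin] with ε hε hpos
    have hpos' : 0 < ε := hpos
    refine key _ (by simp; linarith) fun h => hε ⟨h, hpos'.ne'⟩
  have hc : ∀ R : ℝ[X], Tendsto (fun ε : ℝ => ‖aeval (s + ε * 1) R‖) (𝓝[>] 0) (𝓝 ‖aeval s R‖) := by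
    intro R
    have h : Continuous fun ε : ℝ => ‖aeval (s + ε * 1) R‖ :=
      (continuous_aeval_comp R (by fun_prop)).norm
    simpa using (h.tendsto 0).mono_left nhdsWithin_le_nhds
  exact le_of_tendsto_of_tendsto (hc P) ((hc Q).const_mul g) hev

/-- Each monomial is dominated by one term of the series of `exp (η ‖z‖)`. This supplies the growth
condition of Phragmén–Lindelöf. -/
theorem exists_norm_aeval_le_exp (p : ℝ[X]) {η : ℝ} (hη : 0 < η) :
    ∃ K : ℝ, 0 ≤ K ∧ ∀ z : ℂ, ‖aeval z p‖ ≤ K * Real.exp (η * ‖z‖) := by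
  refine ⟨∑ k ∈ p.support, ‖p.coeff k‖ * (k.factorial / η ^ k),
    Finset.sum_nonneg fun k _ => by positivity, fun z => ?_⟩
  rw [aeval_eq_sum_range' (Nat.lt_succ_self _), Finset.sum_mul]
  have h0 : ∑ i ∈ Finset.range (p.natDegree + 1), p.coeff i • z ^ i =
      ∑ i ∈ p.support, p.coeff i • z ^ i := by
    symm
    refine Finset.sum_subset p.supp_subset_range_natDegree_succ fun k _ hk => ?_
    simp [notMem_support_iff.1 hk]
  rw [h0]
  refine (norm_sum_le _ _).trans (Finset.sum_le_sum fun k _ => ?_)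
  have h1 := Real.pow_div_factorial_le_exp (η * ‖z‖) (by positivity) k
  have h2 : ‖z‖ ^ k ≤ k.factorial / η ^ k * Real.exp (η * ‖z‖) := by
    calc ‖z‖ ^ k = k.factorial / η ^ k * ((η * ‖z‖) ^ k / k.factorial) := by
          rw [mul_pow]; field_simp
      _ ≤ _ := by gcongr
  rw [norm_smul, norm_pow, mul_assoc]
  gcongr

theorem exists_le_norm_aeval_cobounded {q : ℝ[X]} (hq : q ≠ 0) :
    ∃ m : ℝ, 0 < m ∧ ∀ᶠ z in Bornology.cobounded ℂ, m ≤ ‖aeval z q‖ := by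
  by_cases hd : 0 < q.degree
  · refine ⟨1, one_pos, ?_⟩
    have h := tendsto_norm_atTop (q.map (algebraMap ℝ ℂ)) (by simpa using hd)
      (tendsto_norm_cobounded_atTop (E := ℂ))
    filter_upwards [h.eventually_ge_atTop 1] with z hz
    simpa [aeval_def, eval_map] using hz
  · obtain ⟨c, hc⟩ : ∃ c, q = C c := ⟨_, eq_C_of_degree_le_zero (not_lt.1 hd)⟩
    have hc0 : c ≠ 0 := by rintro rfl; simp [hc] at hq
    exact ⟨‖c‖, norm_pos_iff.2 hc0, .of_forall fun z => by simp [hc]⟩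

theorem isBigO_aeval_div_aeval_mul_exp {p q : ℝ[X]} (hq : q ≠ 0) {η : ℝ} (hη : 0 < η) :
    (fun z : ℂ => aeval z p / aeval z q) =O[Bornology.cobounded ℂ]
      fun z => Real.exp (η * ‖z‖) := by
  obtain ⟨K, hK, hp⟩ := exists_norm_aeval_le_exp p hη
  obtain ⟨m, hm, hq⟩ := exists_le_norm_aeval_cobounded hq
  refine .of_bound (K / m) ?_
  filter_upwards [hq] with z hz
  rw [norm_div, Real.norm_of_nonneg (Real.exp_nonneg _), div_mul_eq_mul_div]
  have := hp z
  gcongr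

/-- Maximum principle on the right half-plane for rational functions. -/
theorem norm_aeval_le_of_imaginary_axis {p q : ℝ[X]} {K : ℝ}
    (hq : ∀ s : ℂ, 0 ≤ s.re → aeval s q ≠ 0)
    (h : ∀ ω : ℝ, ‖aeval (ω * Complex.I : ℂ) p‖ ≤ K * ‖aeval (ω * Complex.I : ℂ) q‖)
    {s : ℂ} (hs : 0 ≤ s.re) : ‖aeval s p‖ ≤ K * ‖aeval s q‖ := by
  have hq0 : q ≠ 0 := by rintro rfl; exact hq 0 le_rfl (by simp)
  -- The quotient is not assumed proper, so it may grow along the real axis. The factor `exp (-δ s)`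
  -- forces decay there, has modulus 1 on the imaginary axis, and disappears as `δ → 0`.
  have key : ∀ δ : ℝ, 0 < δ →
      ‖aeval s p / aeval s q * Complex.exp (-(δ * s))‖ ≤ K := by
    intro δ hδ
    refine PhragmenLindelof.right_half_plane_of_tendsto_zero_on_real
      (f := fun z => aeval z p / aeval z q * Complex.exp (-(δ * z))) ?_ ?_ ?_ ?_ hs
    · refine DifferentiableOn.diffContOnCl ?_
      rw [Complex.closure_setOfPred_lt_re]
      intro z hz
      have hp' : DifferentiableAt ℂ (fun z : ℂ => aeval z p) z :=
        p.differentiable_aeval.differentiableAt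
      have hq' : DifferentiableAt ℂ (fun z : ℂ => aeval z q) z :=
        q.differentiable_aeval.differentiableAt
      exact ((hp'.fun_div hq' (hq z hz)).fun_mul (by fun_prop)).differentiableWithinAt
    · refine ⟨1, by norm_num, 1, ?_⟩
      have h1 := (isBigO_aeval_div_aeval_mul_exp (p := p) hq0 one_pos).mono
        (inf_le_left : Bornology.cobounded ℂ ⊓ 𝓟 {z : ℂ | 0 < z.re} ≤ _)
      have h2 : (fun z : ℂ => Complex.exp (-(δ * z)))
          =O[Bornology.cobounded ℂ ⊓ 𝓟 {z : ℂ | 0 < z.re}] fun _ => (1 : ℝ) := by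
        refine .of_bound 1 (mem_inf_of_right fun z hz => ?_)
        have hz' : 0 < z.re := hz
        simp [Complex.norm_exp]
        positivity
      simpa using h1.mul h2
    -- Growth at rate `δ / 2` loses against decay at rate `δ`.
    · have h1 : (fun x : ℝ => aeval (x : ℂ) p / aeval (x : ℂ) q) =O[atTop]
          fun x => Real.exp (δ / 2 * ‖(x : ℂ)‖) :=
        (isBigO_aeval_div_aeval_mul_exp hq0 (half_pos hδ)).comp_tendsto
          ((RCLike.tendsto_ofReal_atTop_cobounded ℂ))
      have h2 : (fun x : ℝ => Complex.exp (-(δ * x))) =O[atTop]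
          fun x : ℝ => Real.exp (-(δ * x)) :=
        .of_bound 1 (.of_forall fun x => by simp [Complex.norm_exp])
      refine (h1.mul h2).trans_tendsto ?_
      have h3 : Tendsto (fun x : ℝ => Real.exp (-(δ / 2 * x))) atTop (𝓝 0) :=
        Real.tendsto_exp_neg_atTop_nhds_zero.comp (tendsto_id.const_mul_atTop (half_pos hδ))
      refine h3.congr' ?_
      filter_upwards [eventually_ge_atTop 0] with x hx
      rw [← Real.exp_add, Complex.norm_real, Real.norm_of_nonneg hx]
      congr 1
      ring
    · intro x
      have h1 := hq (x * Complex.I) (by simp)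
      rw [norm_mul, norm_div, Complex.norm_exp]
      have h2 := h x
      have h3 : 0 < ‖aeval (x * Complex.I : ℂ) q‖ := norm_pos_iff.2 h1
      simpa using (div_le_iff₀ h3).2 h2
  have hlim : Tendsto (fun δ : ℝ => ‖aeval s p / aeval s q * Complex.exp (-(δ * s))‖) (𝓝[>] 0)
      (𝓝 ‖aeval s p / aeval s q‖) := by
    have hc : Continuous fun δ : ℝ => ‖aeval s p / aeval s q * Complex.exp (-(δ * s))‖ := by
      fun_prop
    simpa using (hc.tendsto 0).mono_left nhdsWithin_le_nhds
  have hle := le_of_tendsto hlim (eventually_nhdsWithin_of_forall fun δ hδ => key δ hδ)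
  rwa [norm_div, div_le_iff₀ (norm_pos_iff.2 (hq s hs))] at hle

theorem hInfNorm_le_of_imaginary_axis (hQ : Q ≠ 0)
    (hG : G = algebraMap ℝ[X] (RatFunc ℝ) P / algebraMap ℝ[X] (RatFunc ℝ) Q)
    (hpole : ∀ s : ℂ, 0 < s.re → ¬ IsPole G s) {K : ℝ}
    (h : ∀ ω : ℝ, ω ≠ 0 → aeval (ω * Complex.I : ℂ) Q ≠ 0 →
      ‖aeval (ω * Complex.I : ℂ) P‖ ≤ K * ‖aeval (ω * Complex.I : ℂ) Q‖) :
    hInfNorm G ≤ ENNReal.ofReal K := by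
  have hnum := num_mul_eq_mul_denom hQ hG
  have hax : ∀ ω : ℝ, ‖aeval (ω * Complex.I : ℂ) G.num‖ ≤
      K * ‖aeval (ω * Complex.I : ℂ) G.denom‖ := by
    have hfin := (finite_setOf_aeval_line_eq_zero hQ 0 Complex.I_ne_zero).union
      (Set.finite_singleton (0 : ℝ))
    refine le_of_forall_notMem_finite (continuous_aeval_comp _ (by fun_prop)).norm
      ((continuous_aeval_comp _ (by fun_prop)).norm.const_mul K) hfin fun ω hω => ?_
    simp only [Set.mem_union, not_or, zero_add, Set.mem_ofPred_eq, Set.mem_singleton_iff] at hω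
    have h1 := h ω hω.2 hω.1
    have h3 := congrArg (fun p => ‖aeval (ω * Complex.I : ℂ) p‖) hnum
    simp only [map_mul, norm_mul] at h3
    refine le_of_mul_le_mul_right ?_ (norm_pos_iff.2 hω.1)
    rw [h3]
    nlinarith [norm_nonneg (aeval (ω * Complex.I : ℂ) G.denom)]
  -- On the axis the bound itself excludes poles: a zero of the denominator would be a zero of the
  -- numerator, against coprimality.
  have hden : ∀ s : ℂ, 0 ≤ s.re → aeval s G.denom ≠ 0 := by
    intro s hs hs0
    rcases hs.lt_or_eq with hs | hs
    · exact hpole s hs hs0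
    · have hsI : s = s.im * Complex.I := by
        apply Complex.ext <;> simp [← hs]
      refine RatFunc.not_isZero_of_isPole hs0 ?_
      have := hax s.im
      rw [← hsI, hs0, norm_zero, mul_zero] at this
      exact norm_le_zero_iff.1 this
  refine sSup_le ?_
  rintro _ ⟨s, hs, -, rfl⟩
  have h1 := norm_aeval_le_of_imaginary_axis hden hax hs.le
  rw [← ofReal_norm]
  refine ENNReal.ofReal_le_ofReal ?_
  rw [RatFunc.eval, norm_div]
  exact (div_le_iff₀ (norm_pos_iff.2 (hden s hs.le))).2 h1

/-- A pole of `P / Q` is a point where `Q` vanishes to higher order than `P`; `l` is the order of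
`P`. -/
theorem exists_taylor_coeff_of_isPole (hQ : Q ≠ 0)
    (hG : G = algebraMap ℝ[X] (RatFunc ℝ) P / algebraMap ℝ[X] (RatFunc ℝ) Q)
    {s : ℂ} (hs : IsPole G s) :
    ∃ l : ℕ, (taylor s (P.map (algebraMap ℝ ℂ))).coeff l ≠ 0 ∧
      (∀ j < l, (taylor s (P.map (algebraMap ℝ ℂ))).coeff j = 0) ∧
      ∀ j ≤ l, (taylor s (Q.map (algebraMap ℝ ℂ))).coeff j = 0 := by
  set φ := algebraMap ℝ ℂ
  have hnum := congrArg (fun p => taylor s (p.map φ)) (num_mul_eq_mul_denom hQ hG)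
  simp only [Polynomial.map_mul, taylor_mul] at hnum
  have hd : X ∣ taylor s (G.denom.map φ) := by
    rw [X_dvd_iff, taylor_coeff_zero, eval_map_algebraMap]
    exact hs
  have hn : ¬ X ∣ taylor s (G.num.map φ) := by
    rw [X_dvd_iff, taylor_coeff_zero, eval_map_algebraMap]
    exact RatFunc.not_isZero_of_isPole hs
  have hP : taylor s (P.map φ) ≠ 0 := by
    intro h0
    rw [h0, zero_mul, mul_eq_zero] at hnum
    rcases hnum with h | h
    · exact hn (by simp [h])
    · rw [taylor_eq_zero, Polynomial.map_eq_zero] at h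
      exact hQ h
  refine ⟨(taylor s (P.map φ)).natTrailingDegree, ?_, ?_, ?_⟩
  · simpa [trailingCoeff] using trailingCoeff_nonzero_iff_nonzero.2 hP
  · exact fun j hj => coeff_eq_zero_of_lt_natTrailingDegree hj
  · have h1 : X ^ (taylor s (P.map φ)).natTrailingDegree ∣ taylor s (P.map φ) :=
      X_pow_dvd_iff.2 fun j hj => coeff_eq_zero_of_lt_natTrailingDegree hj
    have h2 := mul_dvd_mul h1 hd
    rw [← pow_succ, ← hnum] at h2
    have h3 := prime_X.pow_dvd_of_dvd_mul_left _ hn h2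
    exact fun j hj => X_pow_dvd_iff.1 h3 j (Nat.lt_succ_of_le hj)

end

end HInf

/-! ### Modulated signals -/

section Signals

open Filter Topology
open scoped ContDiff

/-- The value at `t` of `p(d/dt) ψ`. -/
def derivPairing (ψ : ℝ → ℝ) (t : ℝ) : ℂ[X] →ₗ[ℂ] ℂ :=
  Polynomial.lsum fun j => LinearMap.id.smulRight ((iteratedDeriv j ψ t : ℝ) : ℂ)

/-- The value at `t` of `p(d/dt) (κ e^{st} ψ)`. -/
def modulated (κ s : ℂ) (ψ : ℝ → ℝ) (t : ℝ) : ℂ[X] →ₗ[ℂ] ℂ :=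
  (κ * Complex.exp (s * t)) • derivPairing ψ t ∘ₗ taylor s

/-- The value at `t` of `p(d/dt) (Re (κ e^{st} ψ))`. -/
def reModulated (κ s : ℂ) (ψ : ℝ → ℝ) (t : ℝ) : ℝ[X] →ₗ[ℝ] ℝ :=
  Complex.reLm ∘ₗ (modulated κ s ψ t).restrictScalars ℝ ∘ₗ
    (mapAlgHom (Algebra.ofId ℝ ℂ)).toLinearMap

theorem derivPairing_apply (ψ : ℝ → ℝ) (t : ℝ) (p : ℂ[X]) :
    derivPairing ψ t p = ∑ j ∈ Finset.range (p.natDegree + 1),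
      p.coeff j * ((iteratedDeriv j ψ t : ℝ) : ℂ) := by
  simp only [derivPairing, lsum_apply, LinearMap.smulRight_apply, LinearMap.id_apply, smul_eq_mul]
  exact sum_over_range _ (by simp)

theorem derivPairing_monomial (ψ : ℝ → ℝ) (t : ℝ) (j : ℕ) (c : ℂ) :
    derivPairing ψ t (monomial j c) = c * ((iteratedDeriv j ψ t : ℝ) : ℂ) := by
  simp [derivPairing, lsum_apply, sum_monomial_index]

theorem modulated_apply (κ s : ℂ) (ψ : ℝ → ℝ) (t : ℝ) (p : ℂ[X]) :
    modulated κ s ψ t p = κ * Complex.exp (s * t) * derivPairing ψ t (taylor s p) := rfl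

theorem reModulated_apply (κ s : ℂ) (ψ : ℝ → ℝ) (t : ℝ) (p : ℝ[X]) :
    reModulated κ s ψ t p = (modulated κ s ψ t (p.map (algebraMap ℝ ℂ))).re := rfl

theorem hasDerivAt_iteratedDeriv {ψ : ℝ → ℝ} (hψ : ContDiff ℝ ∞ ψ) (j : ℕ) (t : ℝ) :
    HasDerivAt (iteratedDeriv j ψ) (iteratedDeriv (j + 1) ψ t) t := by
  rw [iteratedDeriv_succ]
  exact ((hψ.differentiable_iteratedDeriv j (by exact_mod_cast ENat.natCast_lt_top j)) t).hasDerivAt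

theorem hasDerivAt_derivPairing {ψ : ℝ → ℝ} (hψ : ContDiff ℝ ∞ ψ) (p : ℂ[X]) (t : ℝ) :
    HasDerivAt (fun t => derivPairing ψ t p) (derivPairing ψ t (X * p)) t := by
  induction p using Polynomial.induction_on' with
  | add p q hp hq =>
    simp only [mul_add, map_add]
    exact hp.add hq
  | monomial j c =>
    simp only [X_mul_monomial, derivPairing_monomial]
    exact (hasDerivAt_iteratedDeriv hψ j t).ofReal_comp.const_mul c

/-- Differentiation in time is multiplication by `X`: `taylor s` sends `X` to `X + s`, which is
Leibniz' rule for `exp (s t) ψ`. -/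
theorem hasDerivAt_modulated {ψ : ℝ → ℝ} (hψ : ContDiff ℝ ∞ ψ) (κ s : ℂ) (p : ℂ[X]) (t : ℝ) :
    HasDerivAt (fun t => modulated κ s ψ t p) (modulated κ s ψ t (X * p)) t := by
  simp only [modulated_apply]
  have h1 : HasDerivAt (fun t : ℝ => κ * Complex.exp (s * t))
      (κ * (Complex.exp (s * t) * (s * 1))) t :=
    ((((hasDerivAt_id (t : ℂ)).comp_ofReal).const_mul s).cexp).const_mul κ
  refine (h1.mul (hasDerivAt_derivPairing hψ (taylor s p) t)).congr_deriv ?_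
  rw [taylor_mul, taylor_X, add_mul, map_add, ← smul_eq_C_mul, map_smul, smul_eq_mul]
  ring

theorem hasDerivAt_reModulated {ψ : ℝ → ℝ} (hψ : ContDiff ℝ ∞ ψ) (κ s : ℂ) (p : ℝ[X]) (t : ℝ) :
    HasDerivAt (fun t => reModulated κ s ψ t p) (reModulated κ s ψ t (X * p)) t := by
  have h := hasDerivAt_modulated hψ κ s (p.map (algebraMap ℝ ℂ)) t
  have h2 := Complex.reCLM.hasFDerivAt.comp_hasDerivAt t h
  simpa [reModulated_apply, Function.comp_def] using h2

theorem continuous_reModulated {ψ : ℝ → ℝ} (hψ : ContDiff ℝ ∞ ψ) (κ s : ℂ) (p : ℝ[X]) :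
    Continuous fun t => reModulated κ s ψ t p :=
  continuous_iff_continuousAt.2 fun t => (hasDerivAt_reModulated hψ κ s p t).continuousAt

theorem reModulated_ofReal_mul (r : ℝ) (κ s : ℂ) (ψ : ℝ → ℝ) (t : ℝ) (p : ℝ[X]) :
    reModulated (r * κ) s ψ t p = r * reModulated κ s ψ t p := by
  rw [reModulated_apply, reModulated_apply, modulated_apply, modulated_apply, mul_assoc, mul_assoc,
    Complex.re_ofReal_mul, mul_assoc]

/-- The phases `1` and `-i` give the real and imaginary parts of one complex signal. Energies are
estimated for the complex signal, and one of the two real signals then inherits the estimate. -/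
theorem reModulated_sq_add_sq (s : ℂ) (ψ : ℝ → ℝ) (t : ℝ) (p : ℝ[X]) :
    reModulated 1 s ψ t p ^ 2 + reModulated (-Complex.I) s ψ t p ^ 2 =
      ‖modulated 1 s ψ t (p.map (algebraMap ℝ ℂ))‖ ^ 2 := by
  have h : modulated (-Complex.I) s ψ t (p.map (algebraMap ℝ ℂ)) =
      -Complex.I * modulated 1 s ψ t (p.map (algebraMap ℝ ℂ)) := by
    simp only [modulated_apply]; ring
  rw [reModulated_apply, reModulated_apply, h, Complex.sq_norm, Complex.normSq_apply]
  simp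
  ring

theorem reModulated_eq_zero_of_eventuallyEq {ψ : ℝ → ℝ} {t : ℝ} (h : ψ =ᶠ[𝓝 t] fun _ => 0)
    (κ s : ℂ) (p : ℝ[X]) : reModulated κ s ψ t p = 0 := by
  have h0 : ∀ j, iteratedDeriv j ψ t = 0 := fun j => by
    rw [h.iteratedDeriv_eq j]
    simp
  rw [reModulated_apply, modulated_apply, derivPairing_apply]
  simp [h0]

theorem reModulated_add_period {ψ : ℝ → ℝ} {T : ℝ} (hψ : ∀ t, ψ (t + T) = ψ t) {s : ℂ}
    (hs : Complex.exp (s * T) = 1) (κ : ℂ) (t : ℝ) (p : ℝ[X]) :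
    reModulated κ s ψ (t + T) p = reModulated κ s ψ t p := by
  have h0 : ∀ j, iteratedDeriv j ψ (t + T) = iteratedDeriv j ψ t := fun j => by
    have := congrFun (iteratedDeriv_comp_add_const j ψ T) t
    rw [← this]
    congr 1
    ext t
    exact hψ t
  simp only [reModulated_apply, modulated_apply, derivPairing_apply, h0, Complex.ofReal_add,
    mul_add, Complex.exp_add, hs, mul_one]

section Trajectories

variable {n : ℕ} {A : Matrix (Fin n) (Fin n) ℝ} {B : Fin n → ℝ}

theorem memLp_two_of_continuousOn_Icc {u : ℝ → ℝ} {T : ℝ} (hu : ContinuousOn u (Set.Icc 0 T)) :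
    MemLp u 2 (volume.restrict (Set.Icc 0 T)) := by
  obtain ⟨K, hK⟩ := isCompact_Icc.exists_bound_of_continuousOn hu
  exact MemLp.of_bound (hu.aestronglyMeasurable measurableSet_Icc) K
    ((ae_restrict_iff' measurableSet_Icc).2 (.of_forall hK))

theorem isL2e_of_continuous {u : ℝ → ℝ} (hu : Continuous u) : IsL2e u := fun _ _ =>
  memLp_two_of_continuousOn_Icc hu.continuousOn

/-- Reading `X` as `d/dt`, the identity `(X - A) v = h B` is the differential equation. -/
theorem isTrajectory_reModulated {ψ : ℝ → ℝ} (hψ : ContDiff ℝ ∞ ψ) (κ s : ℂ)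
    {v : Fin n → ℝ[X]} {h : ℝ[X]}
    (hv : ∀ i, X * v i = ∑ j, C (A i j) * v j + h * C (B i)) :
    IsTrajectory A B (fun t => reModulated κ s ψ t h) (fun t i => reModulated κ s ψ t (v i)) := by
  have hx : Continuous fun t i => reModulated κ s ψ t (v i) :=
    continuous_pi fun i => continuous_reModulated hψ κ s (v i)
  have hu := continuous_reModulated hψ κ s h
  refine ⟨isL2e_of_continuous hu, hx.continuousOn, fun t _ => ?_⟩
  have hd : ∀ t, HasDerivAt (fun t i => reModulated κ s ψ t (v i))
      (A *ᵥ (fun i => reModulated κ s ψ t (v i)) + reModulated κ s ψ t h • B) t := by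
    intro t
    refine hasDerivAt_pi.2 fun i => ?_
    refine (hasDerivAt_reModulated hψ κ s (v i) t).congr_deriv ?_
    rw [hv i, mul_comm h]
    simp only [← smul_eq_C_mul, map_add, map_sum, map_smul, smul_eq_mul]
    simp [Matrix.mulVec, dotProduct, mul_comm]
  rw [intervalIntegral.integral_eq_sub_of_hasDerivAt (fun t _ => hd t)]
  · abel
  · refine Continuous.intervalIntegrable ?_ _ _
    exact (Continuous.matrix_mulVec continuous_const hx).add (hu.smul continuous_const)

theorem output_reModulated (κ s : ℂ) (ψ : ℝ → ℝ) (v : Fin n → ℝ[X]) (h : ℝ[X]) (c : Fin n → ℝ)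
    (D : ℝ) :
    output c D (fun t => reModulated κ s ψ t h) (fun t i => reModulated κ s ψ t (v i)) =
      fun t => reModulated κ s ψ t ((fun i => C (c i)) ⬝ᵥ v + C D * h) := by
  ext t
  simp only [output, dotProduct, ← smul_eq_C_mul, map_add, map_sum, map_smul, smul_eq_mul]

end Trajectories

end Signals

/-! ### Signals that approach the gain at a frequency -/

section Windows

open Filter Topology
open scoped ContDiff

theorem energyOn_eq_ofReal {T : ℝ} (hT : 0 ≤ T) {u : ℝ → ℝ}
    (hu : MemLp u 2 (volume.restrict (Set.Icc 0 T))) :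
    energyOn T u = ENNReal.ofReal (∫ t in (0 : ℝ)..T, u t ^ 2) := by
  rw [energyOn, intervalIntegral.integral_of_le hT, ← integral_Icc_eq_integral_Ioc,
    ofReal_integral_eq_lintegral_ofReal hu.integrable_sq (.of_forall fun t => sq_nonneg _)]
  refine lintegral_congr fun t => ?_
  rw [← ofReal_norm, ← ENNReal.ofReal_pow (norm_nonneg _), Real.norm_eq_abs, sq_abs]

/-- A smooth `1`-periodic function that vanishes near the integers. -/
def periodicBump (t : ℝ) : ℝ := expNegInvGlue (Real.sin (Real.pi * t) ^ 2 - 1 / 2)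

theorem contDiff_periodicBump : ContDiff ℝ ∞ periodicBump := by
  have h : ContDiff ℝ ∞ fun t : ℝ => Real.sin (Real.pi * t) ^ 2 - 1 / 2 := by fun_prop
  exact expNegInvGlue.contDiff.comp h

theorem periodicBump_add_one (t : ℝ) : periodicBump (t + 1) = periodicBump t := by
  rw [periodicBump, mul_add, mul_one, Real.sin_add_pi, neg_sq]
  rfl

theorem periodicBump_eventuallyEq_zero : periodicBump =ᶠ[𝓝 0] fun _ => 0 := by
  have h : Continuous fun t : ℝ => Real.sin (Real.pi * t) ^ 2 - 1 / 2 := by fun_prop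
  have h0 : ∀ᶠ t in 𝓝 (0 : ℝ), Real.sin (Real.pi * t) ^ 2 - 1 / 2 < 0 :=
    (h.tendsto 0).eventually_lt_const (by simp)
  filter_upwards [h0] with t ht
  exact expNegInvGlue.zero_of_nonpos ht.le

theorem integral_periodicBump_sq_pos : 0 < ∫ t in (0 : ℝ)..1, periodicBump t ^ 2 := by
  refine intervalIntegral.integral_pos one_pos
    (contDiff_periodicBump.continuous.pow 2).continuousOn (fun t _ => sq_nonneg _)
    ⟨1 / 2, by norm_num, ?_⟩
  have h : 0 < periodicBump (1 / 2) := by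
    refine expNegInvGlue.pos_of_pos ?_
    rw [mul_one_div, Real.sin_pi_div_two]
    norm_num
  positivity

/-- The energy of `p(ε d/dt)` applied to the bump, over one period. -/
def windowEnergy (p : ℂ[X]) (ε : ℝ) : ℝ :=
  ∫ t in (0 : ℝ)..1, ‖∑ j ∈ Finset.range (p.natDegree + 1),
    p.coeff j * ((ε ^ j * iteratedDeriv j periodicBump t : ℝ) : ℂ)‖ ^ 2

theorem continuous_windowEnergy (p : ℂ[X]) : Continuous (windowEnergy p) := by
  refine intervalIntegral.continuous_parametric_intervalIntegral_of_continuous' ?_ _ _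
  have h : ∀ j, Continuous (iteratedDeriv j periodicBump) := fun j =>
    contDiff_periodicBump.continuous_iteratedDeriv j (by exact_mod_cast le_top)
  rw [Function.uncurry_def]
  refine (Continuous.norm (continuous_finsetSum _ fun j _ => ?_)).pow 2
  have := (h j).comp (continuous_snd (X := ℝ))
  exact continuous_const.mul (Complex.continuous_ofReal.comp ((continuous_fst.pow j).mul this))

/-- The limit of an infinitely wide window: only the constant coefficient survives, which after
`taylor (w i)` is the value at `w i`. -/
theorem windowEnergy_zero (p : ℂ[X]) :
    windowEnergy p 0 = ‖p.coeff 0‖ ^ 2 * ∫ t in (0 : ℝ)..1, periodicBump t ^ 2 := by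
  rw [windowEnergy, ← intervalIntegral.integral_const_mul]
  refine intervalIntegral.integral_congr fun t _ => ?_
  simp [Finset.sum_range_succ', mul_pow]

theorem integral_norm_modulated_sq {T : ℝ} (hT : 0 < T) (w : ℝ) (P : ℂ[X]) :
    ∫ t in (0 : ℝ)..T,
      ‖modulated 1 (w * Complex.I) (fun t => periodicBump (T⁻¹ * t)) t P‖ ^ 2 =
      T * windowEnergy (taylor (w * Complex.I) P) T⁻¹ := by
  set p := taylor (w * Complex.I) P
  let g : ℝ → ℝ := fun τ => ‖∑ j ∈ Finset.range (p.natDegree + 1),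
    p.coeff j * (((T⁻¹) ^ j * iteratedDeriv j periodicBump τ : ℝ) : ℂ)‖ ^ 2
  have h1 : ∀ t : ℝ, ‖modulated 1 (w * Complex.I) (fun t => periodicBump (T⁻¹ * t)) t P‖ ^ 2 =
      g (T⁻¹ * t) := by
    intro t
    have h2 : ‖Complex.exp (w * Complex.I * t)‖ = 1 := by
      rw [mul_right_comm, ← Complex.ofReal_mul, Complex.norm_exp_ofReal_mul_I]
    rw [modulated_apply, norm_mul, one_mul, h2, one_mul, derivPairing_apply]
    congr 3 with j
    rw [congrFun (iteratedDeriv_comp_const_mul (n := j)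
      (contDiff_periodicBump.of_le (by exact_mod_cast le_top)) T⁻¹) t]
  refine (intervalIntegral.integral_congr fun t _ => h1 t).trans
    ((intervalIntegral.integral_comp_mul_left g (inv_ne_zero hT.ne')).trans ?_)
  simp [windowEnergy, hT.ne', g]

theorem exists_periodic_signal {P Q : ℝ[X]} {w : ℝ} (hw : w ≠ 0) {c b : ℝ} (hc : 0 ≤ c)
    (hb : 0 ≤ b)
    (h : c * ‖aeval (w * Complex.I : ℂ) Q‖ ^ 2 < ‖aeval (w * Complex.I : ℂ) P‖ ^ 2) :
    ∃ T : ℝ, 0 < T ∧ ∃ (κ s : ℂ) (ψ : ℝ → ℝ), ContDiff ℝ ∞ ψ ∧ (∀ t, ψ (t + T) = ψ t) ∧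
      Complex.exp (s * T) = 1 ∧ ψ =ᶠ[𝓝 0] (fun _ => 0) ∧
      energyOn T (fun t => reModulated κ s ψ t Q) ≤ ENNReal.ofReal b ∧
      energyOn T (fun t => reModulated κ s ψ t P) = ENNReal.ofReal (b * c) := by
  set φ := algebraMap ℝ ℂ
  set p := taylor (w * Complex.I) (P.map φ)
  set q := taylor (w * Complex.I) (Q.map φ)
  have hpq : c * windowEnergy q 0 < windowEnergy p 0 := by
    rw [windowEnergy_zero, windowEnergy_zero, taylor_coeff_zero, taylor_coeff_zero,
      eval_map_algebraMap, eval_map_algebraMap, ← mul_assoc]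
    exact mul_lt_mul_of_pos_right h integral_periodicBump_sq_pos
  have hev : ∀ᶠ ε in 𝓝 (0 : ℝ), c * windowEnergy q ε < windowEnergy p ε :=
    (((continuous_windowEnergy q).const_mul c).tendsto 0).eventually_lt
      ((continuous_windowEnergy p).tendsto 0) hpq
  -- The window width is a whole number of periods of `exp (i w t)`, so that the product is
  -- periodic.
  have hlim : Tendsto (fun k : ℕ => (2 * Real.pi * k / |w|)⁻¹) atTop (𝓝 0) := by
    refine tendsto_inv_atTop_zero.comp (Tendsto.atTop_div_const (abs_pos.2 hw) ?_)
    exact tendsto_natCast_atTop_atTop.const_mul_atTop Real.two_pi_pos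
  obtain ⟨k, hk, hk0⟩ := ((hlim.eventually hev).and (eventually_gt_atTop 0)).exists
  set T := 2 * Real.pi * k / |w| with hTdef
  have hT : 0 < T := by
    have : (0 : ℝ) < k := by exact_mod_cast hk0
    have := Real.pi_pos
    have := abs_pos.2 hw
    positivity
  set s : ℂ := w * Complex.I
  set ψ : ℝ → ℝ := fun t => periodicBump (T⁻¹ * t)
  have hψ : ContDiff ℝ ∞ ψ := contDiff_periodicBump.comp (by fun_prop)
  have hψT : ∀ t, ψ (t + T) = ψ t := fun t => by
    simp only [ψ, mul_add, inv_mul_cancel₀ hT.ne', periodicBump_add_one]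
  have hψ0 : ψ =ᶠ[𝓝 0] fun _ => 0 := by
    have : Tendsto (fun t : ℝ => T⁻¹ * t) (𝓝 0) (𝓝 0) := by
      simpa using (continuous_const_mul T⁻¹).tendsto (0 : ℝ)
    exact periodicBump_eventuallyEq_zero.comp_tendsto this
  have hs : Complex.exp (s * T) = 1 := by
    rw [Complex.exp_eq_one_iff]
    rcases lt_or_gt_of_ne hw with h0 | h0
    · refine ⟨-k, ?_⟩
      have h1 : w * T = -k * (2 * Real.pi) := by
        rw [hTdef, abs_of_neg h0]; field_simp
      have h2 : (w : ℂ) * T = -k * (2 * Real.pi) := by exact_mod_cast h1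
      push_cast
      linear_combination Complex.I * h2
    · refine ⟨k, ?_⟩
      have h1 : w * T = k * (2 * Real.pi) := by
        rw [hTdef, abs_of_pos h0]; field_simp
      have h2 : (w : ℂ) * T = k * (2 * Real.pi) := by exact_mod_cast h1
      push_cast
      linear_combination Complex.I * h2
  have hcont := fun κ => fun R : ℝ[X] => continuous_reModulated hψ κ s R
  let E : ℂ → ℝ[X] → ℝ := fun κ R => ∫ t in (0 : ℝ)..T, reModulated κ s ψ t R ^ 2
  have hE0 : ∀ κ R, 0 ≤ E κ R := fun κ R =>
    intervalIntegral.integral_nonneg hT.le fun t _ => sq_nonneg _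
  have hE : ∀ R : ℝ[X], E 1 R + E (-Complex.I) R =
      T * windowEnergy (taylor s (R.map φ)) T⁻¹ := fun R => by
    have h1 : ∀ κ, IntervalIntegrable (fun t => reModulated κ s ψ t R ^ 2) volume 0 T :=
      fun κ => ((hcont κ R).pow 2).intervalIntegrable _ _
    rw [← integral_norm_modulated_sq hT]
    refine (intervalIntegral.integral_add (h1 1) (h1 (-Complex.I))).symm.trans ?_
    exact intervalIntegral.integral_congr fun t _ => reModulated_sq_add_sq s ψ t R
  -- The strict inequality holds for the sum over the two phases, hence for one of them.
  obtain ⟨κ, hκ⟩ : ∃ κ, c * E κ Q < E κ P := by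
    by_contra! hcon
    have h1 := hcon 1
    have h2 := hcon (-Complex.I)
    have h3 : T * windowEnergy p T⁻¹ ≤ c * (T * windowEnergy q T⁻¹) := by
      rw [← hE P, ← hE Q]
      linarith
    nlinarith
  have hP : 0 < E κ P := lt_of_le_of_lt (mul_nonneg hc (hE0 κ Q)) hκ
  -- This scaling makes the energy for `P` exactly `b * c`; the choice of `κ` then keeps the energy
  -- for `Q` within `b`.
  have henergy : ∀ R : ℝ[X], energyOn T (fun t => reModulated (√(b * c / E κ P) * κ) s ψ t R) =
      ENNReal.ofReal (b * c / E κ P * E κ R) := fun R => by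
    rw [energyOn_eq_ofReal hT.le (memLp_two_of_continuousOn_Icc (hcont _ R).continuousOn)]
    simp only [reModulated_ofReal_mul, mul_pow, intervalIntegral.integral_const_mul]
    rw [Real.sq_sqrt (by positivity)]
  refine ⟨T, hT, √(b * c / E κ P) * κ, s, ψ, hψ, hψT, hs, hψ0, ?_, ?_⟩
  · rw [henergy]
    refine ENNReal.ofReal_le_ofReal ?_
    rw [div_mul_eq_mul_div, div_le_iff₀ hP]
    nlinarith
  · rw [henergy, div_mul_cancel₀ _ hP.ne']

/-- Once switched on, the signal is `t ^ l exp (s t)`. Derivatives of `t ^ l` beyond order `l`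
vanish, so `Q(d/dt)` kills it, while `P(d/dt)` leaves a nonzero multiple of the growing `exp (s t)`.
-/
theorem exists_unbounded_signal {P Q : ℝ[X]} {s : ℂ} (hs : 0 < s.re) {b : ℝ} (hb : 0 < b) {l : ℕ}
    (hPl : (taylor s (P.map (algebraMap ℝ ℂ))).coeff l ≠ 0)
    (hPj : ∀ j < l, (taylor s (P.map (algebraMap ℝ ℂ))).coeff j = 0)
    (hQj : ∀ j ≤ l, (taylor s (Q.map (algebraMap ℝ ℂ))).coeff j = 0) :
    ∃ (κ : ℂ) (ψ : ℝ → ℝ), ContDiff ℝ ∞ ψ ∧ ψ =ᶠ[𝓝 0] (fun _ => 0) ∧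
      energy (fun t => reModulated κ s ψ t Q) ≤ ENNReal.ofReal b ∧
      energy (fun t => reModulated κ s ψ t P) = ⊤ := by
  set φ := algebraMap ℝ ℂ
  -- Zero up to time 1 and equal to `t ^ l` from time 2 on, so the response to `Q` lives on `[0,
  -- 2]`.
  let ψ : ℝ → ℝ := fun t => Real.smoothTransition (t - 1) * t ^ l
  have hψ : ContDiff ℝ ∞ ψ :=
    (Real.smoothTransition.contDiff.comp (by fun_prop)).mul (by fun_prop)
  have hψ0 : ψ =ᶠ[𝓝 0] fun _ => 0 := by
    filter_upwards [Iio_mem_nhds (zero_lt_one (α := ℝ))] with t ht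
    have ht' : t < 1 := ht
    simp [ψ, Real.smoothTransition.zero_of_nonpos (show t - 1 ≤ 0 by linarith)]
  have hψl : ∀ t : ℝ, 2 < t → ∀ j, iteratedDeriv j ψ t = l.descFactorial j * t ^ (l - j) := by
    intro t ht j
    rw [← iteratedDeriv_pow]
    refine Filter.EventuallyEq.iteratedDeriv_eq j ?_
    filter_upwards [Ioi_mem_nhds ht] with τ hτ
    have hτ' : 2 < τ := hτ
    simp [ψ, Real.smoothTransition.one_of_one_le (show 1 ≤ τ - 1 by linarith)]
  have hzero : ∀ t : ℝ, 2 < t → ∀ j, l < j → iteratedDeriv j ψ t = 0 := fun t ht j hj => by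
    simp [hψl t ht, Nat.descFactorial_eq_zero_iff_lt.2 hj]
  have hQ0 : ∀ κ, ∀ t : ℝ, 2 < t → reModulated κ s ψ t Q = 0 := by
    intro κ t ht
    have : derivPairing ψ t (taylor s (Q.map φ)) = 0 := by
      rw [derivPairing_apply]
      refine Finset.sum_eq_zero fun j _ => ?_
      rcases le_or_gt j l with hj | hj
      · simp [hQj j hj]
      · simp [hzero t ht j hj]
    simp [reModulated_apply, modulated_apply, φ, this]
  set p := taylor s (P.map φ)
  have hP0 : ∀ t : ℝ, 2 < t → ‖p.coeff l‖ ≤ ‖modulated 1 s ψ t (P.map φ)‖ := by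
    intro t ht
    have h1 : derivPairing ψ t p = p.coeff l * l.factorial := by
      rw [derivPairing_apply, Finset.sum_eq_single l]
      · simp [hψl t ht, Nat.descFactorial_self]
      · intro j _ hj
        rcases lt_or_gt_of_ne hj with hj | hj
        · simp [hPj j hj]
        · simp [hzero t ht j hj]
      · intro hl
        exact absurd (Finset.mem_range.2 (Nat.lt_succ_of_le (le_natDegree_of_ne_zero hPl))) hl
    have h2 : (1 : ℝ) ≤ ‖Complex.exp (s * t)‖ := by
      rw [Complex.norm_exp]
      refine Real.one_le_exp ?_
      simp
      nlinarith
    have h3 : (1 : ℝ) ≤ ‖(l.factorial : ℂ)‖ := by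
      rw [Complex.norm_natCast]
      exact_mod_cast Nat.one_le_iff_ne_zero.2 l.factorial_ne_zero
    rw [modulated_apply, h1, one_mul, norm_mul, norm_mul]
    have := norm_nonneg (p.coeff l)
    calc ‖p.coeff l‖ = 1 * (‖p.coeff l‖ * 1) := by ring
      _ ≤ _ := by gcongr
  have hcont := fun κ => fun R : ℝ[X] => continuous_reModulated hψ κ s R
  obtain ⟨κ, hκ⟩ : ∃ κ, energy (fun t => reModulated κ s ψ t P) = ⊤ := by
    have hsum : energy (fun t => reModulated 1 s ψ t P) +
        energy (fun t => reModulated (-Complex.I) s ψ t P) = ⊤ := by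
      rw [energy, energy, ← lintegral_add_left (by
        have := hcont 1 P
        exact (this.enorm.measurable.pow_const 2))]
      rw [← top_le_iff]
      calc (⊤ : ℝ≥0∞) = ∫⁻ t in Set.Ioi (2 : ℝ), ENNReal.ofReal (‖p.coeff l‖ ^ 2) := by
            rw [setLIntegral_const, Real.volume_Ioi, ENNReal.mul_top]
            simpa using hPl
        _ ≤ ∫⁻ t in Set.Ioi (2 : ℝ), (‖reModulated 1 s ψ t P‖ₑ ^ 2 +
              ‖reModulated (-Complex.I) s ψ t P‖ₑ ^ 2) := by
            refine setLIntegral_mono' measurableSet_Ioi fun t ht => ?_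
            rw [← ofReal_norm, ← ofReal_norm, ← ENNReal.ofReal_pow (norm_nonneg _),
              ← ENNReal.ofReal_pow (norm_nonneg _), ← ENNReal.ofReal_add (by positivity)
              (by positivity), Real.norm_eq_abs, Real.norm_eq_abs, sq_abs, sq_abs,
              reModulated_sq_add_sq]
            have := hP0 t ht
            gcongr
        _ ≤ _ := lintegral_mono_set fun t ht => by
            have : (2 : ℝ) < t := ht
            exact (by linarith : (0 : ℝ) ≤ t)
    rcases ENNReal.add_eq_top.1 hsum with h | h
    · exact ⟨_, h⟩
    · exact ⟨_, h⟩
  have hfin : energy (fun t => reModulated κ s ψ t Q) ≤ energyOn 2 (fun t => reModulated κ s ψ t Q)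
      := by
    rw [energy, energyOn, ← lintegral_indicator measurableSet_Ici,
      ← lintegral_indicator measurableSet_Icc]
    refine lintegral_mono fun t => ?_
    by_cases ht : 2 < t
    · simp [Set.indicator, hQ0 κ t ht]
    · simp only [Set.indicator, Set.mem_Ici, Set.mem_Icc, not_lt.1 ht, and_true]
      exact le_rfl
  rw [energyOn_eq_ofReal two_pos.le (memLp_two_of_continuousOn_Icc (hcont κ Q).continuousOn)]
    at hfin
  set e := ∫ t in (0 : ℝ)..2, reModulated κ s ψ t Q ^ 2
  have he : 0 ≤ e := intervalIntegral.integral_nonneg two_pos.le fun t _ => sq_nonneg _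
  -- The `+ 1` covers the case `e = 0`.
  have hr : 0 < b / (e + 1) := by positivity
  have hscale : ∀ R : ℝ[X], energy (fun t => reModulated (√(b / (e + 1)) * κ) s ψ t R) =
      ENNReal.ofReal (b / (e + 1)) * energy (fun t => reModulated κ s ψ t R) := fun R => by
    simp only [energy, reModulated_ofReal_mul, enorm_mul, mul_pow]
    rw [lintegral_const_mul' _ _ (by simp)]
    congr 1
    rw [← ofReal_norm, ← ENNReal.ofReal_pow (norm_nonneg _), Real.norm_eq_abs, sq_abs,
      Real.sq_sqrt hr.le]
  refine ⟨√(b / (e + 1)) * κ, ψ, hψ, hψ0, ?_, ?_⟩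
  · rw [hscale]
    calc _ ≤ ENNReal.ofReal (b / (e + 1)) * ENNReal.ofReal e := by gcongr
      _ = ENNReal.ofReal (b / (e + 1) * e) := (ENNReal.ofReal_mul hr.le).symm
      _ ≤ _ := by
        refine ENNReal.ofReal_le_ofReal ?_
        rw [div_mul_eq_mul_div, div_le_iff₀ (by positivity)]
        nlinarith
  · rw [hscale, hκ, ENNReal.mul_top]
    simpa using hr

end Windows

/-! ### Lower bounds for the gains -/

section LowerBounds

open Filter Topology

/-! ### Cutting a trajectory off when its state is zero. -/

section Truncation

variable {n : ℕ} {A : Matrix (Fin n) (Fin n) ℝ} {B : Fin n → ℝ} {u : ℝ → ℝ} {x : ℝ → Fin n → ℝ}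
  {T : ℝ}

theorem IsL2e.intervalIntegrable (hu : IsL2e u) (hT : 0 ≤ T) :
    IntervalIntegrable u volume 0 T := by
  rw [intervalIntegrable_iff_integrableOn_Ioc_of_le hT]
  rcases hT.eq_or_lt with rfl | hT
  · simp
  · exact ((hu T hT).integrable (by norm_num)).mono_measure
      (Measure.restrict_mono Set.Ioc_subset_Icc_self le_rfl)

theorem continuousOn_uIcc_of_Ici {E : Type*} [TopologicalSpace E] {f : ℝ → E}
    (hf : ContinuousOn f (Set.Ici 0)) (hT : 0 ≤ T) : ContinuousOn f (Set.uIcc 0 T) := by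
  rw [Set.uIcc_of_le hT]
  exact hf.mono Set.Icc_subset_Ici_self

theorem IsTrajectory.intervalIntegrable (h : IsTrajectory A B u x) (hT : 0 ≤ T) :
    IntervalIntegrable (fun τ => A *ᵥ x τ + u τ • B) volume 0 T := by
  have hx : ContinuousOn (fun τ => A *ᵥ x τ) (Set.uIcc 0 T) :=
    (Continuous.matrix_mulVec continuous_const continuous_id).comp_continuousOn
      (continuousOn_uIcc_of_Ici h.2.1 hT)
  refine hx.intervalIntegrable.add ?_
  have := h.1.intervalIntegrable hT
  exact this.smul_continuousOn continuousOn_const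

theorem IsTrajectory.truncate (h : IsTrajectory A B u x) (hT : 0 ≤ T) (hxT : x T = 0) :
    IsTrajectory A B ((Set.Iic T).indicator u) ((Set.Iic T).indicator x) := by
  refine ⟨fun S hS => (h.1 S hS).indicator measurableSet_Iic, ?_, fun t ht => ?_⟩
  · have h1 : ContinuousOn (fun t => x (min t T)) (Set.Ici 0) :=
      h.2.1.comp (by fun_prop) fun t ht => le_min ht hT
    refine h1.congr fun t _ => ?_
    dsimp only
    rcases le_or_gt t T with htT | htT
    · rw [Set.indicator_of_mem (Set.mem_Iic.2 htT), min_eq_left htT]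
    · rw [Set.indicator_of_notMem (by simpa using htT), min_eq_right htT.le, hxT]
  · have hle : ∀ S, 0 ≤ S → S ≤ T → ∫ τ in (0 : ℝ)..S, (A *ᵥ (Set.Iic T).indicator x τ +
        (Set.Iic T).indicator u τ • B) = ∫ τ in (0 : ℝ)..S, (A *ᵥ x τ + u τ • B) := by
      intro S hS hST
      refine intervalIntegral.integral_congr fun τ hτ => ?_
      rw [Set.uIcc_of_le hS] at hτ
      have : τ ∈ Set.Iic T := hτ.2.trans hST
      simp only [Set.indicator_of_mem this]
    have h0 : (Set.Iic T).indicator x 0 = x 0 := Set.indicator_of_mem (Set.mem_Iic.2 hT) x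
    rcases le_or_gt t T with htT | htT
    · rw [hle t ht htT, h0, Set.indicator_of_mem (Set.mem_Iic.2 htT), ← h.2.2 t ht]
    · have hzero : ∀ τ ∈ Set.uIoc T t, A *ᵥ (Set.Iic T).indicator x τ +
          (Set.Iic T).indicator u τ • B = 0 := by
        intro τ hτ
        rw [Set.uIoc_of_le htT.le] at hτ
        have : τ ∉ Set.Iic T := not_le.2 hτ.1
        simp [Set.indicator_of_notMem this]
      have hi : IntervalIntegrable (fun τ => A *ᵥ (Set.Iic T).indicator x τ +
          (Set.Iic T).indicator u τ • B) volume 0 T := by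
        refine (h.intervalIntegrable hT).congr fun τ hτ => ?_
        rw [Set.uIoc_of_le hT] at hτ
        have : τ ∈ Set.Iic T := hτ.2
        simp only [Set.indicator_of_mem this]
      have hi' : IntervalIntegrable (fun τ => A *ᵥ (Set.Iic T).indicator x τ +
          (Set.Iic T).indicator u τ • B) volume T t :=
        (IntervalIntegrable.zero (E := Fin n → ℝ)).congr fun τ hτ => (hzero τ hτ).symm
      rw [← intervalIntegral.integral_add_adjacent_intervals hi hi', hle T hT le_rfl,
        intervalIntegral.integral_congr_ae (g := fun _ => 0) (.of_forall hzero),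
        intervalIntegral.integral_zero, add_zero, h0, ← h.2.2 T hT, hxT,
        Set.indicator_of_notMem (by simpa using htT)]

theorem output_indicator (c : Fin n → ℝ) (D : ℝ) (s : Set ℝ) :
    output c D (s.indicator u) (s.indicator x) = s.indicator (output c D u x) := by
  ext t
  by_cases ht : t ∈ s <;> simp [output, ht]

theorem energy_indicator_Iic (T : ℝ) (y : ℝ → ℝ) :
    energy ((Set.Iic T).indicator y) = energyOn T y := by
  rw [energy, energyOn, ← Set.Ici_inter_Iic, Set.inter_comm,
    ← Measure.restrict_restrict measurableSet_Iic, ← lintegral_indicator measurableSet_Iic]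
  refine lintegral_congr fun t => ?_
  by_cases ht : t ∈ Set.Iic T <;> simp [ht]

end Truncation

theorem AttackSystem.periodicOog_zero_le_oog {n : ℕ} (S : AttackSystem n) :
    S.periodicOog {0} ≤ S.oog := by
  refine sSup_le ?_
  rintro _ ⟨T, a, x, ⟨hT, h, hper⟩, hx0, he, rfl⟩
  have hx0 : x 0 = 0 := hx0
  have hxT : x T = 0 := by simpa [hx0] using (hper 0 le_rfl).1
  refine le_sSup ⟨_, _, h.truncate hT.le hxT, ?_, ?_, ?_⟩
  · rw [Set.indicator_of_mem (Set.mem_Iic.2 hT.le), hx0]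
  · rwa [output_indicator, energy_indicator_Iic]
  · rw [output_indicator, energy_indicator_Iic]

theorem FaultSystem.periodicIig_zero_le_iig {n : ℕ} (S : FaultSystem n) :
    S.periodicIig {0} {0} ≤ S.iig := by
  refine sSup_le ?_
  rintro _ ⟨T, f, d, xf, xd, ⟨hT, hf, hfper⟩, hxf0, ⟨-, hd, hdper⟩, hxd0, heq, he, rfl⟩
  have hxf0 : xf 0 = 0 := hxf0
  have hxd0 : xd 0 = 0 := hxd0
  have hxfT : xf T = 0 := by simpa [hxf0] using (hfper 0 le_rfl).1
  have hxdT : xd T = 0 := by simpa [hxd0] using (hdper 0 le_rfl).1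
  refine le_sSup ⟨_, _, _, _, hf.truncate hT.le hxfT, ?_, hd.truncate hT.le hxdT, ?_, ?_, ?_, ?_⟩
  · rw [Set.indicator_of_mem (Set.mem_Iic.2 hT.le), hxf0]
  · rw [Set.indicator_of_mem (Set.mem_Iic.2 hT.le), hxd0]
  · filter_upwards [heq] with t ht
    rw [output_indicator, output_indicator, Set.indicator_apply, Set.indicator_apply, ht]
  · rwa [energy_indicator_Iic]
  · rw [energy_indicator_Iic]

/-! ### Test signals in the two systems. -/

section Systems

variable {n : ℕ}

theorem isPeriodicTrajectory_reModulated {A : Matrix (Fin n) (Fin n) ℝ} {B : Fin n → ℝ}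
    {ψ : ℝ → ℝ} (hψ : ContDiff ℝ (⊤ : ℕ∞) ψ) {T : ℝ} (hT : 0 < T) (hψT : ∀ t, ψ (t + T) = ψ t)
    (κ : ℂ) {s : ℂ} (hs : Complex.exp (s * T) = 1) {v : Fin n → ℝ[X]} {h : ℝ[X]}
    (hv : ∀ i, X * v i = ∑ j, C (A i j) * v j + h * C (B i)) :
    IsPeriodicTrajectory A B T (fun t => reModulated κ s ψ t h)
      (fun t i => reModulated κ s ψ t (v i)) :=
  ⟨hT, isTrajectory_reModulated hψ κ s hv, fun t _ =>
    ⟨funext fun i => reModulated_add_period hψT hs κ t (v i), reModulated_add_period hψT hs κ t h⟩⟩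

theorem resolventNum_mul_eq (A : Matrix (Fin n) (Fin n) ℝ) (B : Fin n → ℝ) (R : ℝ[X])
    (i : Fin n) :
    X * (resolventNum A B i * R) =
      ∑ j, C (A i j) * (resolventNum A B j * R) + A.charpoly * R * C (B i) := by
  have h := X_mul_resolventNum A B i
  have h2 : ∑ j, C (A i j) * (resolventNum A B j * R) =
      (∑ j, C (A i j) * resolventNum A B j) * R := by
    rw [Finset.sum_mul]
    exact Finset.sum_congr rfl fun j _ => by ring
  rw [h2]
  linear_combination R * h

theorem output_resolventNum_mul (A : Matrix (Fin n) (Fin n) ℝ) (B c : Fin n → ℝ) (D : ℝ)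
    (R : ℝ[X]) :
    ((fun i => C (c i)) ⬝ᵥ fun i => resolventNum A B i * R) + C D * (A.charpoly * R) =
      transferNum A B c D * R := by
  rw [transferNum, add_mul, dotProduct, dotProduct, Finset.sum_mul]
  congr 1
  · exact Finset.sum_congr rfl fun j _ => by ring
  · ring

namespace AttackSystem

variable (S : AttackSystem n)

/-- The numerator of the transfer function to `y_r`. -/
def numR : ℝ[X] := transferNum S.A S.B S.Cr S.Dr

/-- The numerator of the transfer function to `y_p`. -/
def numP : ℝ[X] := transferNum S.A S.B S.Cp S.Dp

theorem le_periodicOog {w : ℝ} (hw : w ≠ 0) {c : ℝ} (hc : 0 ≤ c)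
    (h : c * ‖aeval (w * Complex.I : ℂ) S.numR‖ ^ 2 < ‖aeval (w * Complex.I : ℂ) S.numP‖ ^ 2) :
    ENNReal.ofReal c ≤ S.periodicOog {0} := by
  obtain ⟨T, hT, κ, s, ψ, hψ, hψT, hs, hψ0, hQ, hP⟩ := exists_periodic_signal hw hc zero_le_one h
  refine le_sSup ⟨T, _, _, isPeriodicTrajectory_reModulated hψ hT hψT κ hs
    (X_mul_resolventNum S.A S.B), ?_, ?_, ?_⟩
  · exact funext fun i => reModulated_eq_zero_of_eventuallyEq hψ0 κ s _
  · rw [output_reModulated]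
    exact hQ.trans_eq ENNReal.ofReal_one
  · rw [output_reModulated]
    rw [one_mul] at hP
    exact hP.symm

theorem oog_eq_top {s : ℂ} (hs : 0 < s.re) {G : RatFunc ℝ} (hR : S.numR ≠ 0)
    (hG : G = algebraMap ℝ[X] (RatFunc ℝ) S.numP / algebraMap ℝ[X] (RatFunc ℝ) S.numR)
    (hpole : IsPole G s) : S.oog = ∞ := by
  obtain ⟨l, h1, h2, h3⟩ := exists_taylor_coeff_of_isPole hR hG hpole
  obtain ⟨κ, ψ, hψ, hψ0, hQ, hP⟩ := exists_unbounded_signal hs one_pos h1 h2 h3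
  refine top_le_iff.1 (le_sSup ⟨_, _, isTrajectory_reModulated hψ κ s
    (X_mul_resolventNum S.A S.B), ?_, ?_, ?_⟩)
  · exact funext fun i => reModulated_eq_zero_of_eventuallyEq hψ0 κ s _
  · rw [output_reModulated]
    exact hQ.trans_eq ENNReal.ofReal_one
  · rw [output_reModulated]
    exact hP.symm

end AttackSystem

namespace FaultSystem

variable (S : FaultSystem n)

/-- The numerator of the transfer function from `f`. -/
def numF : ℝ[X] := transferNum S.A S.Bf S.C S.Df

/-- The numerator of the transfer function from `d`. -/
def numD : ℝ[X] := transferNum S.A S.Bd S.C S.Dd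

/-- Driving each channel with the numerator of the other makes both residuals `numF numD (d/dt)` of
the same signal. -/
theorem output_eq_output (κ s : ℂ) (ψ : ℝ → ℝ) :
    output S.C S.Df (fun t => reModulated κ s ψ t (S.A.charpoly * S.numD))
        (fun t i => reModulated κ s ψ t (resolventNum S.A S.Bf i * S.numD)) =
      output S.C S.Dd (fun t => reModulated κ s ψ t (S.A.charpoly * S.numF))
        (fun t i => reModulated κ s ψ t (resolventNum S.A S.Bd i * S.numF)) := by
  rw [output_reModulated, output_reModulated, output_resolventNum_mul, output_resolventNum_mul]
  change (fun t => reModulated κ s ψ t (S.numF * S.numD)) =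
    fun t => reModulated κ s ψ t (S.numD * S.numF)
  rw [mul_comm]

theorem le_periodicIig {w : ℝ} (hw : w ≠ 0) {c : ℝ} (hc : 0 ≤ c)
    (h : c * ‖aeval (w * Complex.I : ℂ) (S.A.charpoly * S.numF)‖ ^ 2 <
      ‖aeval (w * Complex.I : ℂ) (S.A.charpoly * S.numD)‖ ^ 2) :
    ENNReal.ofReal (4 * c) ≤ S.periodicIig {0} {0} := by
  obtain ⟨T, hT, κ, s, ψ, hψ, hψT, hs, hψ0, hQ, hP⟩ :=
    exists_periodic_signal hw hc (zero_le_four (α := ℝ)) h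
  refine le_sSup ⟨T, _, _, _, _,
    isPeriodicTrajectory_reModulated hψ hT hψT κ hs (resolventNum_mul_eq S.A S.Bf S.numD), ?_,
    isPeriodicTrajectory_reModulated hψ hT hψT κ hs (resolventNum_mul_eq S.A S.Bd S.numF), ?_,
    ?_, ?_, hP.symm⟩
  · exact funext fun i => reModulated_eq_zero_of_eventuallyEq hψ0 κ s _
  · exact funext fun i => reModulated_eq_zero_of_eventuallyEq hψ0 κ s _
  · exact .of_forall fun t => congrFun (S.output_eq_output κ s ψ) t
  · simpa using hQ

theorem iig_eq_top {s : ℂ} (hs : 0 < s.re) {G : RatFunc ℝ} (hF : S.A.charpoly * S.numF ≠ 0)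
    (hG : G = algebraMap ℝ[X] (RatFunc ℝ) (S.A.charpoly * S.numD) /
      algebraMap ℝ[X] (RatFunc ℝ) (S.A.charpoly * S.numF))
    (hpole : IsPole G s) : S.iig = ∞ := by
  obtain ⟨l, h1, h2, h3⟩ := exists_taylor_coeff_of_isPole hF hG hpole
  obtain ⟨κ, ψ, hψ, hψ0, hQ, hP⟩ := exists_unbounded_signal hs (zero_lt_four (α := ℝ)) h1 h2 h3
  refine top_le_iff.1 (le_sSup ⟨_, _, _, _,
    isTrajectory_reModulated hψ κ s (resolventNum_mul_eq S.A S.Bf S.numD), ?_,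
    isTrajectory_reModulated hψ κ s (resolventNum_mul_eq S.A S.Bd S.numF), ?_,
    ?_, ?_, hP.symm⟩)
  · exact funext fun i => reModulated_eq_zero_of_eventuallyEq hψ0 κ s _
  · exact funext fun i => reModulated_eq_zero_of_eventuallyEq hψ0 κ s _
  · exact .of_forall fun t => congrFun (S.output_eq_output κ s ψ) t
  · simpa using hQ

end FaultSystem

end Systems

/-- Here `b` is the energy budget, 1 or 4, and `K` the gain. If the ratio exceeded `√(K / b)` at
some frequency, a `c` strictly between the squares would contradict `h`. -/
theorem mul_hInfNorm_sq_le {P Q : ℝ[X]} {G : RatFunc ℝ} (hQ : Q ≠ 0)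
    (hG : G = algebraMap ℝ[X] (RatFunc ℝ) P / algebraMap ℝ[X] (RatFunc ℝ) Q)
    (hpole : ∀ s : ℂ, 0 < s.re → ¬ IsPole G s) {b : ℝ} (hb : 0 < b) {K : ℝ≥0∞}
    (h : ∀ w c : ℝ, w ≠ 0 → 0 ≤ c →
      c * ‖aeval (w * Complex.I : ℂ) Q‖ ^ 2 < ‖aeval (w * Complex.I : ℂ) P‖ ^ 2 →
      ENNReal.ofReal (b * c) ≤ K) :
    ENNReal.ofReal b * hInfNorm G ^ 2 ≤ K := by
  by_cases hK : K = ∞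
  · simp [hK]
  obtain ⟨k, hk, rfl⟩ : ∃ k : ℝ, 0 ≤ k ∧ K = ENNReal.ofReal k :=
    ⟨K.toReal, ENNReal.toReal_nonneg, (ENNReal.ofReal_toReal hK).symm⟩
  have hB : hInfNorm G ≤ ENNReal.ofReal √(k / b) := by
    refine hInfNorm_le_of_imaginary_axis hQ hG hpole fun w hw hQw => ?_
    by_contra! hlt
    have hQ0 : 0 < ‖aeval (w * Complex.I : ℂ) Q‖ := norm_pos_iff.2 hQw
    have h1 : k / b < ‖aeval (w * Complex.I : ℂ) P‖ ^ 2 / ‖aeval (w * Complex.I : ℂ) Q‖ ^ 2 := by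
      rw [lt_div_iff₀ (by positivity), ← Real.sq_sqrt (show 0 ≤ k / b by positivity), ← mul_pow]
      gcongr
    obtain ⟨c, hc1, hc2⟩ := exists_between h1
    have hc0 : 0 ≤ c := (show 0 ≤ k / b by positivity).trans hc1.le
    have h2 := h w c hw hc0 ((lt_div_iff₀ (by positivity)).1 hc2)
    rw [ENNReal.ofReal_le_ofReal_iff hk] at h2
    rw [div_lt_iff₀ hb] at hc1
    linarith
  calc ENNReal.ofReal b * hInfNorm G ^ 2
      ≤ ENNReal.ofReal b * ENNReal.ofReal √(k / b) ^ 2 := by gcongr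
    _ = ENNReal.ofReal k := by
      rw [← ENNReal.ofReal_pow (Real.sqrt_nonneg _), Real.sq_sqrt (by positivity),
        ← ENNReal.ofReal_mul hb.le, mul_div_cancel₀ _ hb.ne']

end LowerBounds

/-! ### Finite Laplace transforms of trajectories -/

section Laplace

open Filter Topology

/-- The Laplace transform of the restriction of a signal to `[0, T]`. -/
def finiteLaplace (T : ℝ) (s : ℂ) (u : ℝ → ℝ) : ℂ :=
  ∫ t in (0 : ℝ)..T, Complex.exp (-(s * t)) * (u t : ℂ)

variable {T : ℝ} {s : ℂ} {u v : ℝ → ℝ}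

theorem intervalIntegrable_exp_mul (hu : IntervalIntegrable u volume 0 T) :
    IntervalIntegrable (fun t : ℝ => Complex.exp (-(s * t)) * (u t : ℂ)) volume 0 T := by
  have h : IntervalIntegrable (fun t => (u t : ℂ)) volume 0 T :=
    ⟨hu.1.ofReal, hu.2.ofReal⟩
  exact h.continuousOn_mul (by fun_prop)

theorem finiteLaplace_re (hu : IntervalIntegrable u volume 0 T) :
    (finiteLaplace T s u).re = ∫ t in (0 : ℝ)..T, (Complex.exp (-(s * t))).re * u t := by
  have h := Complex.reCLM.intervalIntegral_comp_comm (intervalIntegrable_exp_mul (s := s) hu)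
  rw [finiteLaplace]
  refine h.symm.trans (intervalIntegral.integral_congr fun t _ => ?_)
  simp only [Complex.reCLM_apply, Complex.re_mul_ofReal]

theorem finiteLaplace_im (hu : IntervalIntegrable u volume 0 T) :
    (finiteLaplace T s u).im = ∫ t in (0 : ℝ)..T, (Complex.exp (-(s * t))).im * u t := by
  have h := Complex.imCLM.intervalIntegral_comp_comm (intervalIntegrable_exp_mul (s := s) hu)
  rw [finiteLaplace]
  refine h.symm.trans (intervalIntegral.integral_congr fun t _ => ?_)
  simp only [Complex.imCLM_apply, Complex.im_mul_ofReal]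

theorem finiteLaplace_add (hu : IntervalIntegrable u volume 0 T)
    (hv : IntervalIntegrable v volume 0 T) :
    finiteLaplace T s (fun t => u t + v t) = finiteLaplace T s u + finiteLaplace T s v := by
  rw [finiteLaplace, finiteLaplace, finiteLaplace, ← intervalIntegral.integral_add
    (intervalIntegrable_exp_mul hu) (intervalIntegrable_exp_mul hv)]
  refine intervalIntegral.integral_congr fun t _ => ?_
  simp only [Complex.ofReal_add, mul_add]

theorem finiteLaplace_const_mul (c : ℝ) (u : ℝ → ℝ) :
    finiteLaplace T s (fun t => c * u t) = c * finiteLaplace T s u := by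
  rw [finiteLaplace, finiteLaplace, ← intervalIntegral.integral_const_mul]
  refine intervalIntegral.integral_congr fun t _ => ?_
  simp only [Complex.ofReal_mul]
  ring

theorem finiteLaplace_dotProduct {n : ℕ} {x : ℝ → Fin n → ℝ} (c : Fin n → ℝ)
    (hx : ∀ i, IntervalIntegrable (fun t => x t i) volume 0 T) :
    finiteLaplace T s (fun t => c ⬝ᵥ x t) = ∑ i, (c i : ℂ) * finiteLaplace T s (fun t => x t i) := by
  simp only [finiteLaplace, ← intervalIntegral.integral_const_mul]
  rw [← intervalIntegral.integral_finsetSum fun i _ =>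
    (intervalIntegrable_exp_mul (hx i)).const_mul (c i : ℂ)]
  refine intervalIntegral.integral_congr fun t _ => ?_
  simp only [dotProduct, Complex.ofReal_sum, Complex.ofReal_mul, Finset.mul_sum]
  exact Finset.sum_congr rfl fun i _ => by ring

theorem finiteLaplace_congr_ae (h : ∀ᵐ t ∂volume.restrict (Set.Ici (0 : ℝ)), u t = v t)
    (hT : 0 ≤ T) : finiteLaplace T s u = finiteLaplace T s v := by
  refine intervalIntegral.integral_congr_ae ?_
  rw [ae_restrict_iff' measurableSet_Ici] at h
  filter_upwards [h] with t ht htT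
  rw [Set.uIoc_of_le hT] at htT
  rw [ht htT.1.le]

theorem continuous_finiteLaplace_mul_I (hu : IntervalIntegrable u volume 0 T) :
    Continuous fun w : ℝ => finiteLaplace T (w * Complex.I) u := by
  refine intervalIntegral.continuous_of_dominated_interval (bound := fun t => ‖u t‖)
    (fun w => ?_) (fun w => .of_forall fun t _ => ?_) hu.norm (.of_forall fun t _ => by fun_prop)
  · exact (intervalIntegrable_iff.1 (intervalIntegrable_exp_mul hu)).aestronglyMeasurable
  · rw [norm_mul, Complex.norm_exp]
    simp

/-- Integration by parts against a primitive. -/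
theorem integral_mul_eq_sub_of_primitive {f f' w y : ℝ → ℝ} (hT : 0 ≤ T) (hf : ContDiff ℝ 1 f)
    (hf' : ∀ t, HasDerivAt f (f' t) t) (hw : IntervalIntegrable w volume 0 T)
    (hy : ∀ t, 0 ≤ t → y t = y 0 + ∫ τ in (0 : ℝ)..t, w τ) :
    ∫ t in (0 : ℝ)..T, f t * w t = f T * y T - f 0 * y 0 - ∫ t in (0 : ℝ)..T, f' t * y t := by
  let Y : ℝ → ℝ := fun t => y 0 + ∫ τ in (0 : ℝ)..t, w τ
  have hfac : AbsolutelyContinuousOnInterval f 0 T :=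
    hf.contDiffOn.absolutelyContinuousOnInterval
  have hYac : AbsolutelyContinuousOnInterval Y 0 T := by
    have hconst : AbsolutelyContinuousOnInterval (fun _ : ℝ => y 0) 0 T :=
      (contDiff_const (n := 1)).contDiffOn.absolutelyContinuousOnInterval
    exact hconst.add (hw.absolutelyContinuousOnInterval_intervalIntegral Set.left_mem_uIcc)
  have h := hfac.integral_mul_deriv_eq_deriv_mul hYac
  have h1 : ∫ t in (0 : ℝ)..T, f t * deriv Y t = ∫ t in (0 : ℝ)..T, f t * w t := by
    refine intervalIntegral.integral_congr_ae ?_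
    filter_upwards [hw.ae_hasDerivAt_integral] with t ht htT
    rw [((ht (Set.uIoc_subset_uIcc htT) 0 Set.left_mem_uIcc).const_add (y 0)).deriv]
  have h2 : ∫ t in (0 : ℝ)..T, deriv f t * Y t = ∫ t in (0 : ℝ)..T, f' t * y t := by
    refine intervalIntegral.integral_congr fun t ht => ?_
    rw [Set.uIcc_of_le hT] at ht
    simp only [(hf' t).deriv, hy t ht.1, Y]
  have hYT : Y T = y T := (hy T hT).symm
  have hY0 : Y 0 = y 0 := (hy 0 le_rfl).symm
  rw [← h1, h, h2, hYT, hY0]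

theorem finiteLaplace_of_primitive {w y : ℝ → ℝ} (hT : 0 ≤ T)
    (hw : IntervalIntegrable w volume 0 T) (hyc : ContinuousOn y (Set.Ici 0))
    (hy : ∀ t, 0 ≤ t → y t = y 0 + ∫ τ in (0 : ℝ)..t, w τ) :
    finiteLaplace T s w =
      Complex.exp (-(s * T)) * y T - y 0 + s * finiteLaplace T s y := by
  have hyi : IntervalIntegrable y volume 0 T :=
    (continuousOn_uIcc_of_Ici hyc hT).intervalIntegrable
  have hE : ∀ t : ℝ, HasDerivAt (fun t : ℝ => Complex.exp (-(s * t)))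
      (Complex.exp (-(s * t)) * (-(s * 1))) t := fun t =>
    (((hasDerivAt_id (t : ℂ)).comp_ofReal).const_mul s).neg.cexp
  have hEc : ContDiff ℝ 1 fun t : ℝ => Complex.exp (-(s * t)) :=
    (Complex.contDiff_exp (𝕜 := ℝ)).comp
      (contDiff_const.mul Complex.ofRealCLM.contDiff).neg
  have hci : ∀ g : ℝ → ℝ, Continuous g → IntervalIntegrable (fun t => g t * y t) volume 0 T :=
    fun g hg => hyi.continuousOn_mul hg.continuousOn
  have hre : Continuous fun t : ℝ => (Complex.exp (-(s * t))).re := by fun_prop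
  have him : Continuous fun t : ℝ => (Complex.exp (-(s * t))).im := by fun_prop
  have h1 := integral_mul_eq_sub_of_primitive hT (Complex.reCLM.contDiff.comp hEc)
    (fun t => Complex.reCLM.hasFDerivAt.comp_hasDerivAt t (hE t)) hw hy
  have h2 := integral_mul_eq_sub_of_primitive hT (Complex.imCLM.contDiff.comp hEc)
    (fun t => Complex.imCLM.hasFDerivAt.comp_hasDerivAt t (hE t)) hw hy
  have h3 : ∫ t in (0 : ℝ)..T, (Complex.exp (-(s * t)) * (-(s * 1))).re * y t =
      -(s.re * (finiteLaplace T s y).re - s.im * (finiteLaplace T s y).im) := by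
    rw [finiteLaplace_re hyi, finiteLaplace_im hyi, ← intervalIntegral.integral_const_mul,
      ← intervalIntegral.integral_const_mul, ← intervalIntegral.integral_sub
      ((hci _ hre).const_mul _) ((hci _ him).const_mul _), ← intervalIntegral.integral_neg]
    refine intervalIntegral.integral_congr fun t _ => ?_
    simp only [mul_one, Complex.mul_re, Complex.neg_re, Complex.neg_im]
    ring
  have h4 : ∫ t in (0 : ℝ)..T, (Complex.exp (-(s * t)) * (-(s * 1))).im * y t =
      -(s.re * (finiteLaplace T s y).im + s.im * (finiteLaplace T s y).re) := by
    rw [finiteLaplace_re hyi, finiteLaplace_im hyi, ← intervalIntegral.integral_const_mul,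
      ← intervalIntegral.integral_const_mul, ← intervalIntegral.integral_add
      ((hci _ him).const_mul _) ((hci _ hre).const_mul _), ← intervalIntegral.integral_neg]
    refine intervalIntegral.integral_congr fun t _ => ?_
    simp only [mul_one, Complex.mul_im, Complex.neg_re, Complex.neg_im]
    ring
  simp only [Function.comp_def, Complex.reCLM_apply, Complex.imCLM_apply] at h1 h2
  rw [h3] at h1
  rw [h4] at h2
  apply Complex.ext
  · rw [finiteLaplace_re hw, h1]
    simp
    ring
  · rw [finiteLaplace_im hw, h2]
    simp
    ring

section Trajectory

variable {n : ℕ} {A : Matrix (Fin n) (Fin n) ℝ} {B : Fin n → ℝ} {x : ℝ → Fin n → ℝ}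

theorem IsTrajectory.intervalIntegrable_state (h : IsTrajectory A B u x) (hT : 0 ≤ T) (i : Fin n) :
    IntervalIntegrable (fun t => x t i) volume 0 T :=
  ((continuous_apply i).comp_continuousOn
    (continuousOn_uIcc_of_Ici h.2.1 hT)).intervalIntegrable

theorem IsTrajectory.finiteLaplace_output (h : IsTrajectory A B u x) (hT : 0 ≤ T)
    (c : Fin n → ℝ) (D : ℝ) :
    finiteLaplace T s (output c D u x) =
      ∑ i, (c i : ℂ) * finiteLaplace T s (fun t => x t i) + D * finiteLaplace T s u := by
  have h1 : IntervalIntegrable (fun t => c ⬝ᵥ x t) volume 0 T :=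
    ((continuous_const.dotProduct continuous_id).comp_continuousOn
      (continuousOn_uIcc_of_Ici h.2.1 hT)).intervalIntegrable
  unfold output
  rw [finiteLaplace_add h1 ((h.1.intervalIntegrable hT).const_mul D),
    finiteLaplace_dotProduct _ (h.intervalIntegrable_state hT), finiteLaplace_const_mul]

/-- The hypothesis `hs` says that the boundary term of integration by parts vanishes. It covers
periodic states at harmonics of `2π / T`, and any `s` when the state is zero at both ends. -/
theorem IsTrajectory.finiteLaplace_state (h : IsTrajectory A B u x) (hT : 0 ≤ T)
    (hs : ∀ i, Complex.exp (-(s * T)) * x T i = x 0 i) (i : Fin n) :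
    s * finiteLaplace T s (fun t => x t i) =
      ∑ j, (A i j : ℂ) * finiteLaplace T s (fun t => x t j) + finiteLaplace T s u * B i := by
  have hint : ∀ t, 0 ≤ t → x t i = x 0 i + ∫ τ in (0 : ℝ)..t, (A i ⬝ᵥ x τ + B i * u τ) := by
    intro t ht
    have h1 := (ContinuousLinearMap.proj (R := ℝ) (φ := fun _ : Fin n => ℝ)
      i).intervalIntegral_comp_comm (h.intervalIntegrable ht)
    have h2 := congrFun (h.2.2 t ht) i
    rw [h2, Pi.add_apply]
    congr 1
    refine h1.symm.trans (intervalIntegral.integral_congr fun τ _ => ?_)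
    simp [Matrix.mulVec, mul_comm]
  have hAx : IntervalIntegrable (fun t => A i ⬝ᵥ x t) volume 0 T :=
    ((continuous_const.dotProduct continuous_id).comp_continuousOn
      (continuousOn_uIcc_of_Ici h.2.1 hT)).intervalIntegrable
  have hu := (h.1.intervalIntegrable hT).const_mul (B i)
  have h3 := finiteLaplace_of_primitive (s := s) hT (hAx.add hu)
    ((continuous_apply i).comp_continuousOn h.2.1) hint
  have h4 := finiteLaplace_add (s := s) hAx hu
  rw [finiteLaplace_dotProduct _ (h.intervalIntegrable_state hT), finiteLaplace_const_mul] at h4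
  simp only [Function.comp_def, hs i, sub_self, zero_add] at h3
  rw [← h3]
  refine h4.trans ?_
  rw [mul_comm (B i : ℂ)]

end Trajectory

/-! ### Invariance of the reachable subspace -/

section Reachable

variable {n : ℕ} {A : Matrix (Fin n) (Fin n) ℝ} {B : Fin n → ℝ} {x : ℝ → Fin n → ℝ}

/-- Projecting along a complement turns membership in `W` into a linear equation that passes through
integrals. -/
theorem exists_idempotent_ker_eq (W : Submodule ℝ (Fin n → ℝ)) :
    ∃ K : (Fin n → ℝ) →L[ℝ] (Fin n → ℝ), (∀ x, K x = 0 ↔ x ∈ W) ∧ ∀ x, K (K x) = K x := by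
  obtain ⟨V, hV⟩ := W.exists_isCompl
  refine ⟨LinearMap.toContinuousLinearMap (V.projection W hV.symm), fun x => ?_, fun x => ?_⟩
  · simp
  · exact LinearMap.congr_fun (Submodule.isIdempotentElem_projection hV.symm) x

theorem integral_mem_submodule {W : Submodule ℝ (Fin n → ℝ)} {f : ℝ → Fin n → ℝ} (hT : 0 ≤ T)
    (hf : IntervalIntegrable f volume 0 T) (hW : ∀ t, 0 ≤ t → f t ∈ W) :
    ∫ t in (0 : ℝ)..T, f t ∈ W := by
  obtain ⟨K, hK, -⟩ := exists_idempotent_ker_eq W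
  rw [← hK, ← K.intervalIntegral_comp_comm hf]
  rw [intervalIntegral.integral_congr (g := fun _ => 0), intervalIntegral.integral_zero]
  intro t ht
  rw [Set.uIcc_of_le hT] at ht
  exact (hK _).2 (hW t ht.1)

theorem mulVec_mem_reachable {y : Fin n → ℝ} (hy : y ∈ reachable A B) :
    A *ᵥ y ∈ reachable A B := by
  induction hy using Submodule.span_induction with
  | mem y hy =>
    obtain ⟨k, rfl⟩ := hy
    refine Submodule.subset_span ⟨k + 1, ?_⟩
    simp [pow_succ', Matrix.mulVec_mulVec]
  | zero => simp
  | add y z _ _ hy hz => rw [Matrix.mulVec_add]; exact add_mem hy hz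
  | smul a y _ hy => rw [Matrix.mulVec_smul]; exact Submodule.smul_mem _ _ hy

/-- Modulo the reachable space, which is invariant under `A` and contains `B`, the input drops out.
The class of the state solves a homogeneous linear equation from zero, and Grönwall gives zero. -/
theorem IsTrajectory.mem_reachable (h : IsTrajectory A B u x) (h0 : x 0 ∈ reachable A B) {t : ℝ}
    (ht : 0 ≤ t) : x t ∈ reachable A B := by
  obtain ⟨K, hK, hKK⟩ := exists_idempotent_ker_eq (reachable A B)
  have hB : K B = 0 := (hK B).2 (Submodule.subset_span ⟨0, by simp⟩)
  have hA : ∀ y, K (A *ᵥ y) = K (A *ᵥ K y) := fun y => by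
    have h1 : y - K y ∈ reachable A B := (hK _).1 (by rw [map_sub, hKK, sub_self])
    have h2 := (hK _).2 (mulVec_mem_reachable h1)
    rwa [Matrix.mulVec_sub, map_sub, sub_eq_zero] at h2
  let L : (Fin n → ℝ) →L[ℝ] (Fin n → ℝ) := K ∘L LinearMap.toContinuousLinearMap A.mulVecLin
  -- Freezing the state before time 0 makes `y` continuous on the whole line, so that `Y` below is
  -- differentiable everywhere.
  let y : ℝ → Fin n → ℝ := fun τ => K (x (max τ 0))
  have hy : Continuous y := K.continuous.comp
    (h.2.1.comp_continuous (by fun_prop) fun τ => le_max_right τ 0)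
  let Y : ℝ → Fin n → ℝ := fun t => ∫ τ in (0 : ℝ)..t, L (y τ)
  have hYd : ∀ t, HasDerivAt Y (L (y t)) t := fun t =>
    (L.continuous.comp hy).integral_hasStrictDerivAt 0 t |>.hasDerivAt
  have hYy : ∀ t, 0 ≤ t → Y t = y t := by
    intro t ht
    have h1 : y t = K (x 0 + ∫ τ in (0 : ℝ)..t, (A *ᵥ x τ + u τ • B)) := by
      rw [← h.2.2 t ht]
      simp only [y, max_eq_left ht]
    rw [h1, map_add, (hK _).2 h0, zero_add, ← K.intervalIntegral_comp_comm
      (h.intervalIntegrable ht)]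
    refine intervalIntegral.integral_congr fun τ hτ => ?_
    rw [Set.uIcc_of_le ht] at hτ
    simp only [map_add, map_smul, hB, smul_zero, add_zero, y, max_eq_left hτ.1, L]
    exact (hA _).symm
  have hzero := eq_zero_of_abs_deriv_le_mul_abs_self_of_eq_zero_right (f := Y) (a := 0) (b := t)
    (K := ‖L‖) (fun τ _ => (hYd τ).continuousAt.continuousWithinAt)
    (fun τ _ => (hYd τ).hasDerivWithinAt) (by simp [Y])
    (fun τ hτ => by rw [hYy τ hτ.1]; exact L.le_opNorm _) t ⟨ht, le_rfl⟩
  rw [hYy t ht] at hzero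
  simpa only [y, max_eq_left ht, hK] using hzero

theorem IsTrajectory.finiteLaplace_mem_reachable (h : IsTrajectory A B u x) (h0 : x 0 ∈ reachable A B)
    (hT : 0 ≤ T) (s : ℂ) :
    (fun i => (finiteLaplace T s (fun t => x t i)).re) ∈ reachable A B ∧
      (fun i => (finiteLaplace T s (fun t => x t i)).im) ∈ reachable A B := by
  have key : ∀ g : ℝ → ℝ, Continuous g →
      (fun i => ∫ t in (0 : ℝ)..T, g t * x t i) ∈ reachable A B := by
    intro g hg
    have hi : IntervalIntegrable (fun t => g t • x t) volume 0 T :=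
      (hg.continuousOn.smul (continuousOn_uIcc_of_Ici h.2.1 hT)).intervalIntegrable
    have h1 := integral_mem_submodule hT hi fun t ht =>
      Submodule.smul_mem _ (g t) (h.mem_reachable h0 ht)
    convert h1 using 1
    ext i
    exact (ContinuousLinearMap.proj (R := ℝ) (φ := fun _ : Fin n => ℝ)
      i).intervalIntegral_comp_comm hi
  constructor
  · simp only [finiteLaplace_re (h.intervalIntegrable_state hT _)]
    exact key (fun t => (Complex.exp (-(s * t))).re) (by fun_prop)
  · simp only [finiteLaplace_im (h.intervalIntegrable_state hT _)]
    exact key (fun t => (Complex.exp (-(s * t))).im) (by fun_prop)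

end Reachable

/-- Comparison of energies over `[0, T]` through Fourier coefficients. -/
theorem energyOn_le_of_norm_finiteLaplace_le (hT : 0 < T)
    (hu : MemLp u 2 (volume.restrict (Set.Icc 0 T)))
    (hv : MemLp v 2 (volume.restrict (Set.Icc 0 T))) {g : ℝ} (hg : 0 ≤ g)
    (h : ∀ w : ℝ, Complex.exp (-(w * Complex.I * T)) = 1 →
      ‖finiteLaplace T (w * Complex.I) u‖ ≤ g * ‖finiteLaplace T (w * Complex.I) v‖) :
    energyOn T u ≤ ENNReal.ofReal g ^ 2 * energyOn T v := by
  have hmem : ∀ u : ℝ → ℝ, MemLp u 2 (volume.restrict (Set.Icc 0 T)) →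
      MemLp (fun t => (u t : ℂ)) 2 (volume.restrict (Set.Ioc 0 T)) := fun u hu =>
    (hu.mono_measure (Measure.restrict_mono Set.Ioc_subset_Icc_self le_rfl)).ofReal
  have hsum := fun u hu => hasSum_sq_fourierCoeffOn hT (hmem u hu)
  have hcoeff : ∀ (u : ℝ → ℝ) (k : ℤ), fourierCoeffOn hT (fun t => (u t : ℂ)) k =
      (T⁻¹ : ℝ) • finiteLaplace T ((2 * Real.pi * k / T : ℝ) * Complex.I) u := by
    intro u k
    rw [fourierCoeffOn_eq_integral, finiteLaplace, sub_zero, one_div]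
    congr 1
    refine intervalIntegral.integral_congr fun t _ => ?_
    rw [smul_eq_mul]
    congr 1
    rw [fourier_coe_apply]
    congr 1
    push_cast
    ring
  have hle : T⁻¹ * ∫ t in (0 : ℝ)..T, u t ^ 2 ≤ g ^ 2 * (T⁻¹ * ∫ t in (0 : ℝ)..T, v t ^ 2) := by
    have hu' := hsum u hu
    have hv' := (hsum v hv).mul_left (g ^ 2)
    simp only [sub_zero, smul_eq_mul, Complex.norm_real, Real.norm_eq_abs, sq_abs] at hu' hv'
    refine hasSum_le (fun k => ?_) hu' hv'
    have hk : Complex.exp (-((2 * Real.pi * k / T : ℝ) * Complex.I * T)) = 1 := by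
      rw [Complex.exp_eq_one_iff]
      refine ⟨-k, ?_⟩
      have : (T : ℂ) ≠ 0 := by exact_mod_cast hT.ne'
      push_cast
      field_simp
    rw [hcoeff, hcoeff, norm_smul, norm_smul, ← mul_pow]
    have := h _ hk
    have h2 := norm_nonneg (T⁻¹ : ℝ)
    refine pow_le_pow_left₀ (by positivity) ?_ 2
    calc _ ≤ ‖(T⁻¹ : ℝ)‖ * (g * _) := mul_le_mul_of_nonneg_left this h2
      _ = _ := by ring
  have hle' : ∫ t in (0 : ℝ)..T, u t ^ 2 ≤ g ^ 2 * ∫ t in (0 : ℝ)..T, v t ^ 2 := by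
    refine le_of_mul_le_mul_left ?_ (inv_pos.2 hT)
    linarith
  rw [energyOn_eq_ofReal hT.le hu, energyOn_eq_ofReal hT.le hv, ← ENNReal.ofReal_pow hg,
    ← ENNReal.ofReal_mul (by positivity)]
  exact ENNReal.ofReal_le_ofReal hle'

end Laplace

/-! ### Upper bounds over periodic trajectories -/

section UpperBounds

theorem IsTrajectory.memLp_output {n : ℕ} {A : Matrix (Fin n) (Fin n) ℝ} {B : Fin n → ℝ}
    {u : ℝ → ℝ} {x : ℝ → Fin n → ℝ} (h : IsTrajectory A B u x) {T : ℝ} (hT : 0 < T)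
    (c : Fin n → ℝ) (D : ℝ) :
    MemLp (output c D u x) 2 (volume.restrict (Set.Icc 0 T)) := by
  have h1 : ContinuousOn (fun t => c ⬝ᵥ x t) (Set.Icc 0 T) :=
    (continuous_const.dotProduct continuous_id).comp_continuousOn
      (h.2.1.mono Set.Icc_subset_Ici_self)
  exact (memLp_two_of_continuousOn_Icc h1).add ((h.1 T hT).const_mul D)

namespace AttackSystem

variable {n : ℕ} (S : AttackSystem n)

theorem norm_finiteLaplace_le (hS : IsControllable S.A S.B) {a : ℝ → ℝ} {x : ℝ → Fin n → ℝ}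
    (h : IsTrajectory S.A S.B a x) {T : ℝ} (hT : 0 ≤ T) {w g : ℝ} (hR : S.numR ≠ 0)
    (hg : ∀ w : ℝ, ‖aeval (w * Complex.I : ℂ) S.numP‖ ≤ g * ‖aeval (w * Complex.I : ℂ) S.numR‖)
    (hw : ∀ i, Complex.exp (-(w * Complex.I * T)) * x T i = x 0 i) :
    ‖finiteLaplace T (w * Complex.I) (output S.Cp S.Dp a x)‖ ≤
      g * ‖finiteLaplace T (w * Complex.I) (output S.Cr S.Dr a x)‖ := by
  have hmem : ∀ y, y ∈ reachable S.A S.B := fun y => by rw [hS]; trivial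
  obtain ⟨q, -, hq⟩ := exists_polynomial_solution (hmem _) (hmem _) (h.finiteLaplace_state hT hw)
  obtain ⟨Np, hNp, hNp'⟩ := hq S.Cp S.Dp
  obtain ⟨Nr, hNr, hNr'⟩ := hq S.Cr S.Dr
  rw [h.finiteLaplace_output hT, h.finiteLaplace_output hT, ← hNp, ← hNr]
  have hχ : S.A.charpoly.map (algebraMap ℝ ℂ) ≠ 0 := (S.A.charpoly_monic.map _).ne_zero
  -- The characteristic polynomial is cancelled as a polynomial, so it may vanish at the frequency
  -- `w` itself. Zeros of `numR` on the axis are then handled by continuity of the polynomials `Np`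
  -- and `Nr`.
  have hrel : Np * S.numR.map (algebraMap ℝ ℂ) = Nr * S.numP.map (algebraMap ℝ ℂ) := by
    refine mul_left_cancel₀ hχ ?_
    change _ = q * S.numR.map (algebraMap ℝ ℂ) at hNr'
    change _ = q * S.numP.map (algebraMap ℝ ℂ) at hNp'
    linear_combination S.numR.map (algebraMap ℝ ℂ) * hNp' - S.numP.map (algebraMap ℝ ℂ) * hNr'
  have hfin := finite_setOf_aeval_line_eq_zero hR 0 Complex.I_ne_zero
  refine le_of_forall_notMem_finite (f := fun w : ℝ => ‖Np.eval (w * Complex.I : ℂ)‖)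
    (g := fun w : ℝ => g * ‖Nr.eval (w * Complex.I : ℂ)‖)
    (Np.continuous.comp (by fun_prop)).norm ((Nr.continuous.comp (by fun_prop)).norm.const_mul g)
    hfin (fun t ht => ?_) w
  simp only [zero_add, Set.mem_ofPred_eq] at ht
  have h1 := congrArg (fun p => ‖p.eval (t * Complex.I : ℂ)‖) hrel
  simp only [eval_mul, norm_mul, eval_map_algebraMap] at h1
  refine le_of_mul_le_mul_right ?_ (norm_pos_iff.2 ht)
  rw [h1]
  have := mul_le_mul_of_nonneg_left (hg t) (norm_nonneg (Nr.eval (t * Complex.I : ℂ)))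
  linarith

theorem periodicOog_le (hS : IsControllable S.A S.B) {G : RatFunc ℝ} (hR : S.numR ≠ 0)
    (hG : G = algebraMap ℝ[X] (RatFunc ℝ) S.numP / algebraMap ℝ[X] (RatFunc ℝ) S.numR)
    (X₀ : Set (Fin n → ℝ)) : S.periodicOog X₀ ≤ hInfNorm G ^ 2 := by
  by_cases htop : hInfNorm G = ∞
  · simp [htop]
  obtain ⟨g, hg, hGg⟩ : ∃ g : ℝ, 0 ≤ g ∧ hInfNorm G = ENNReal.ofReal g :=
    ⟨_, ENNReal.toReal_nonneg, (ENNReal.ofReal_toReal htop).symm⟩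
  refine sSup_le ?_
  rintro _ ⟨T, a, x, ⟨hT, h, hper⟩, -, he, rfl⟩
  have hxT : x T = x 0 := by simpa using (hper 0 le_rfl).1
  have hax : ∀ w : ℝ, ‖aeval (w * Complex.I : ℂ) S.numP‖ ≤
      g * ‖aeval (w * Complex.I : ℂ) S.numR‖ := fun w =>
    norm_aeval_le_of_hInfNorm_le hR hG hg hGg.le (by simp)
  have hle := energyOn_le_of_norm_finiteLaplace_le hT (h.memLp_output hT S.Cp S.Dp)
    (h.memLp_output hT S.Cr S.Dr) hg fun w hw =>
      S.norm_finiteLaplace_le hS h hT.le hR hax fun i => by rw [hw, one_mul, hxT]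
  rw [hGg]
  exact hle.trans (mul_le_of_le_one_right' he)

theorem periodicOog_mono {X₀ Y₀ : Set (Fin n → ℝ)} (h : X₀ ⊆ Y₀) :
    S.periodicOog X₀ ≤ S.periodicOog Y₀ := by
  refine sSup_le_sSup ?_
  rintro e ⟨T, a, x, h1, h2, h3⟩
  exact ⟨T, a, x, h1, h h2, h3⟩

theorem div_eq_of_isRightCoprimeFactorization {Nr Np M : RatFunc ℝ}
    (hO : IsRightCoprimeFactorization S.Tr S.Tp Nr Np M) (hNr : Nr ≠ 0) :
    S.numR ≠ 0 ∧ Np / Nr =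
      algebraMap ℝ[X] (RatFunc ℝ) S.numP / algebraMap ℝ[X] (RatFunc ℝ) S.numR := by
  obtain ⟨-, -, -, hM, hTr, hTp, -⟩ := hO
  rw [Tr, transferFunction_eq] at hTr
  rw [Tp, transferFunction_eq] at hTp
  change algebraMap ℝ[X] (RatFunc ℝ) S.numR / _ = _ at hTr
  change algebraMap ℝ[X] (RatFunc ℝ) S.numP / _ = _ at hTp
  have hχ : algebraMap ℝ[X] (RatFunc ℝ) S.A.charpoly ≠ 0 := by
    simpa using S.A.charpoly_monic.ne_zero
  rw [div_eq_iff hχ] at hTr hTp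
  refine ⟨fun h0 => ?_, ?_⟩
  · rw [h0, map_zero, eq_comm] at hTr
    exact mul_ne_zero (mul_ne_zero hNr (inv_ne_zero hM)) hχ hTr
  · rw [hTr, hTp]
    field_simp

end AttackSystem

/-- Evaluation form of `T = M⁻¹ N` for a polynomial multiple of `T`. -/
theorem mul_map_eq_of_eq_inv_mul {P χ : ℝ[X]} (hχ : χ ≠ 0) {N M : RatFunc ℝ} (hM : M ≠ 0)
    (h : algebraMap ℝ[X] (RatFunc ℝ) P / algebraMap ℝ[X] (RatFunc ℝ) χ = M⁻¹ * N)
    {y f : ℂ[X]} (hy : χ.map (algebraMap ℝ ℂ) * y = f * P.map (algebraMap ℝ ℂ)) :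
    y * (M.num * N.denom).map (algebraMap ℝ ℂ) = f * (N.num * M.denom).map (algebraMap ℝ ℂ) := by
  have hpoly : P * (M.num * N.denom) = χ * (N.num * M.denom) := by
    apply RatFunc.algebraMap_injective ℝ
    have hχ' : algebraMap ℝ[X] (RatFunc ℝ) χ ≠ 0 := by simpa using hχ
    have hNd : algebraMap ℝ[X] (RatFunc ℝ) N.denom ≠ 0 := by simpa using N.denom_ne_zero
    have hMd : algebraMap ℝ[X] (RatFunc ℝ) M.denom ≠ 0 := by simpa using M.denom_ne_zero
    have hN := N.num_div_denom
    have hM' := M.num_div_denom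
    rw [div_eq_iff hNd] at hN
    rw [div_eq_iff hMd] at hM'
    rw [div_eq_iff hχ'] at h
    simp only [map_mul, h, hN, hM']
    field_simp
  have hχ' : χ.map (algebraMap ℝ ℂ) ≠ 0 := by simpa using hχ
  have hpoly' := congrArg (Polynomial.map (algebraMap ℝ ℂ)) hpoly
  rw [Polynomial.map_mul, Polynomial.map_mul (p := χ)] at hpoly'
  refine mul_left_cancel₀ hχ' ?_
  linear_combination (M.num * N.denom).map (algebraMap ℝ ℂ) * hy + f * hpoly'

theorem norm_le_of_mul_eq {f d p q : ℂ} {g : ℝ} (hq : q ≠ 0) (h : f * q = d * p)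
    (hpq : ‖p‖ ≤ g * ‖q‖) : ‖f‖ ≤ g * ‖d‖ := by
  refine le_of_mul_le_mul_right ?_ (norm_pos_iff.2 hq)
  rw [← norm_mul, h, norm_mul]
  have := mul_le_mul_of_nonneg_left hpq (norm_nonneg d)
  linarith

namespace FaultSystem

variable {n : ℕ} (S : FaultSystem n) {Nf Nd M : RatFunc ℝ}

/-- With `r` the common residual, `M r = Nf f` and `M r = Nd d` hold between transforms; eliminating
`r` leaves `Nf f = Nd d`, here with denominators cleared. Stability of `M` allows its denominator to
be cancelled on the closed right half-plane. -/
theorem finiteLaplace_mul_eq (hI : IsLeftCoprimeFactorization S.Tf S.Td Nf Nd M)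
    {f d : ℝ → ℝ} {xf xd : ℝ → Fin n → ℝ}
    (hf : IsTrajectory S.A S.Bf f xf) (hxf : xf 0 ∈ reachable S.A S.Bf)
    (hd : IsTrajectory S.A S.Bd d xd) (hxd : xd 0 ∈ reachable S.A S.Bd)
    (heq : ∀ᵐ t ∂volume.restrict (Set.Ici (0 : ℝ)),
      output S.C S.Df f xf t = output S.C S.Dd d xd t)
    {T : ℝ} (hT : 0 ≤ T) {s : ℂ} (hs : 0 ≤ s.re)
    (hfT : ∀ i, Complex.exp (-(s * T)) * xf T i = xf 0 i)
    (hdT : ∀ i, Complex.exp (-(s * T)) * xd T i = xd 0 i) :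
    finiteLaplace T s f * aeval s (Nf.num * Nd.denom) =
      finiteLaplace T s d * aeval s (Nd.num * Nf.denom) := by
  obtain ⟨-, -, hM, hM0, hTf, hTd, -⟩ := hI
  have hχ := S.A.charpoly_monic.ne_zero
  rw [Tf, transferFunction_eq] at hTf
  rw [Td, transferFunction_eq] at hTd
  obtain ⟨F, hF, hF'⟩ := exists_polynomial_solution (hf.finiteLaplace_mem_reachable hxf hT s).1
    (hf.finiteLaplace_mem_reachable hxf hT s).2 (hf.finiteLaplace_state hT hfT)
  obtain ⟨D, hD, hD'⟩ := exists_polynomial_solution (hd.finiteLaplace_mem_reachable hxd hT s).1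
    (hd.finiteLaplace_mem_reachable hxd hT s).2 (hd.finiteLaplace_state hT hdT)
  obtain ⟨yf, hyf, hyf'⟩ := hF' S.C S.Df
  obtain ⟨yd, hyd, hyd'⟩ := hD' S.C S.Dd
  have h1 := congrArg (Polynomial.eval s) (mul_map_eq_of_eq_inv_mul hχ hM0 hTf hyf')
  have h2 := congrArg (Polynomial.eval s) (mul_map_eq_of_eq_inv_mul hχ hM0 hTd hyd')
  have hy : yf.eval s = yd.eval s := by
    rw [hyf, hyd, ← hf.finiteLaplace_output hT, ← hd.finiteLaplace_output hT]
    exact finiteLaplace_congr_ae heq hT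
  simp only [eval_mul, eval_map_algebraMap, map_mul, hF, hD, hy] at h1 h2 ⊢
  have hMd : aeval s M.denom ≠ 0 := fun h => absurd (hM.2 s h) (not_lt.2 hs)
  refine mul_right_cancel₀ hMd ?_
  linear_combination aeval s Nf.denom * h2 - aeval s Nd.denom * h1

theorem div_eq_num_mul_denom (Nf Nd : RatFunc ℝ) :
    Nd / Nf = algebraMap ℝ[X] (RatFunc ℝ) (Nd.num * Nf.denom) /
      algebraMap ℝ[X] (RatFunc ℝ) (Nf.num * Nd.denom) := by
  conv_lhs => rw [← Nd.num_div_denom, ← Nf.num_div_denom]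
  rw [div_div_div_eq, map_mul, map_mul, mul_comm (algebraMap ℝ[X] (RatFunc ℝ) Nd.denom)]

theorem num_mul_denom_ne_zero (hNf : Nf ≠ 0) (Nd : RatFunc ℝ) : Nf.num * Nd.denom ≠ 0 :=
  mul_ne_zero (RatFunc.num_ne_zero hNf) Nd.denom_ne_zero

theorem periodicIig_le {Xf Xd : Set (Fin n → ℝ)}
    (h : ∀ g : ℝ, 0 ≤ g → hInfNorm (Nd / Nf) = ENNReal.ofReal g →
      ∀ (T : ℝ) (f d : ℝ → ℝ) (xf xd : ℝ → Fin n → ℝ), 0 < T →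
        IsTrajectory S.A S.Bf f xf → xf 0 ∈ Xf → xf T = xf 0 →
        IsTrajectory S.A S.Bd d xd → xd 0 ∈ Xd → xd T = xd 0 →
        (∀ᵐ t ∂volume.restrict (Set.Ici (0 : ℝ)),
          output S.C S.Df f xf t = output S.C S.Dd d xd t) →
        ∀ w : ℝ, Complex.exp (-(w * Complex.I * T)) = 1 →
          ‖finiteLaplace T (w * Complex.I) f‖ ≤ g * ‖finiteLaplace T (w * Complex.I) d‖) :
    S.periodicIig Xf Xd ≤ 4 * hInfNorm (Nd / Nf) ^ 2 := by
  by_cases htop : hInfNorm (Nd / Nf) = ∞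
  · simp [htop]
  have hGg := (ENNReal.ofReal_toReal htop).symm
  refine sSup_le ?_
  rintro _ ⟨T, f, d, xf, xd, ⟨hT, hf, hfper⟩, hxf, ⟨-, hd, hdper⟩, hxd, heq, he, rfl⟩
  have hle := energyOn_le_of_norm_finiteLaplace_le hT (hf.1 T hT) (hd.1 T hT)
    ENNReal.toReal_nonneg
    (h _ ENNReal.toReal_nonneg hGg T f d xf xd hT hf hxf (by simpa using (hfper 0 le_rfl).1) hd hxd
      (by simpa using (hdper 0 le_rfl).1) heq)
  rw [← hGg, mul_comm] at hle
  exact hle.trans (by gcongr)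

theorem periodicIig_zero_le (hI : IsLeftCoprimeFactorization S.Tf S.Td Nf Nd M) (hNf : Nf ≠ 0) :
    S.periodicIig {0} {0} ≤ 4 * hInfNorm (Nd / Nf) ^ 2 := by
  refine S.periodicIig_le fun g hg hGg T f d xf xd hT hf hxf hxfT hd hxd hxdT heq w _ => ?_
  have hxf : xf 0 = 0 := hxf
  have hxd : xd 0 = 0 := hxd
  have hq := num_mul_denom_ne_zero hNf Nd
  -- States that vanish at both ends give the relation at every frequency, not only at harmonics, so
  -- imaginary zeros of `Nf` are passed by continuity of the transforms.
  refine le_of_forall_notMem_finite (f := fun w : ℝ => ‖finiteLaplace T (w * Complex.I) f‖)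
    (g := fun w : ℝ => g * ‖finiteLaplace T (w * Complex.I) d‖)
    (continuous_finiteLaplace_mul_I (hf.1.intervalIntegrable hT.le)).norm
    ((continuous_finiteLaplace_mul_I (hd.1.intervalIntegrable hT.le)).norm.const_mul g)
    (finite_setOf_aeval_line_eq_zero hq 0 Complex.I_ne_zero) (fun t ht => ?_) w
  simp only [zero_add, Set.mem_ofPred_eq] at ht
  have h1 := S.finiteLaplace_mul_eq hI hf (by rw [hxf]; exact zero_mem _) hd
    (by rw [hxd]; exact zero_mem _) heq hT.le (s := t * Complex.I) (by simp)
    (fun i => by simp [hxfT, hxf]) (fun i => by simp [hxdT, hxd])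
  exact norm_le_of_mul_eq ht h1
    (norm_aeval_le_of_hInfNorm_le hq (div_eq_num_mul_denom Nf Nd) hg hGg.le (by simp))

theorem periodicIig_reachable_le (hI : IsLeftCoprimeFactorization S.Tf S.Td Nf Nd M)
    (hNf : Nf ≠ 0) (hz : ∀ s : ℂ, s.re = 0 → ¬ (IsZero Nf s ∧ IsZero Nd s)) :
    S.periodicIig (reachable S.A S.Bf) (reachable S.A S.Bd) ≤ 4 * hInfNorm (Nd / Nf) ^ 2 := by
  refine S.periodicIig_le fun g hg hGg T f d xf xd hT hf hxf hxfT hd hxd hxdT heq w hw => ?_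
  have hs : (w * Complex.I : ℂ).re = 0 := by simp
  have hpq := norm_aeval_le_of_hInfNorm_le (num_mul_denom_ne_zero hNf Nd)
    (div_eq_num_mul_denom Nf Nd) hg hGg.le hs.ge
  refine norm_le_of_mul_eq ?_ (S.finiteLaplace_mul_eq hI hf hxf hd hxd heq hT.le hs.ge
    (fun i => by rw [hw, hxfT, one_mul]) (fun i => by rw [hw, hxdT, one_mul])) hpq
  have hden : ∀ N : RatFunc ℝ, IsRHInf N → aeval (w * Complex.I : ℂ) N.denom ≠ 0 :=
    fun N hN h => absurd (hN.2 _ h) (by simp)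
  -- Here only harmonics are available. At a zero of `Nf` the bound would make `Nd` vanish too,
  -- which `hz` forbids.
  intro h0
  rw [h0, norm_zero, mul_zero, norm_le_zero_iff, map_mul] at hpq
  rw [map_mul] at h0
  exact hz _ hs ⟨(mul_eq_zero.1 h0).resolve_right (hden Nd hI.2.1),
    (mul_eq_zero.1 hpq).resolve_right (hden Nf hI.1)⟩

theorem periodicIig_mono {Xf Xd Yf Yd : Set (Fin n → ℝ)} (hf : Xf ⊆ Yf) (hd : Xd ⊆ Yd) :
    S.periodicIig Xf Xd ≤ S.periodicIig Yf Yd := by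
  refine sSup_le_sSup ?_
  rintro e ⟨T, f, d, xf, xd, h1, h2, h3, h4, h5⟩
  exact ⟨T, f, d, xf, xd, h1, hf h2, h3, hd h4, h5⟩

theorem div_eq_of_isLeftCoprimeFactorization
    (hI : IsLeftCoprimeFactorization S.Tf S.Td Nf Nd M) (hNf : Nf ≠ 0) :
    S.A.charpoly * S.numF ≠ 0 ∧ Nd / Nf =
      algebraMap ℝ[X] (RatFunc ℝ) (S.A.charpoly * S.numD) /
        algebraMap ℝ[X] (RatFunc ℝ) (S.A.charpoly * S.numF) := by
  obtain ⟨-, -, -, hM, hTf, hTd, -⟩ := hI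
  rw [Tf, transferFunction_eq] at hTf
  rw [Td, transferFunction_eq] at hTd
  change algebraMap ℝ[X] (RatFunc ℝ) S.numF / _ = _ at hTf
  change algebraMap ℝ[X] (RatFunc ℝ) S.numD / _ = _ at hTd
  have hχ0 := S.A.charpoly_monic.ne_zero
  have hχ : algebraMap ℝ[X] (RatFunc ℝ) S.A.charpoly ≠ 0 := by simpa using hχ0
  rw [div_eq_iff hχ] at hTf hTd
  refine ⟨mul_ne_zero hχ0 fun h0 => ?_, ?_⟩
  · rw [h0, map_zero, eq_comm] at hTf
    exact mul_ne_zero (mul_ne_zero (inv_ne_zero hM) hNf) hχ hTf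
  · rw [map_mul, map_mul, hTf, hTd]
    field_simp

end FaultSystem

end UpperBounds

end

theorem theorem1
    -- the system with one attack input and two outputs
    {n₁ : ℕ} (S : AttackSystem n₁) (hS : IsControllable S.A S.B)
    (Nr Np MO : RatFunc ℝ) (hO : IsRightCoprimeFactorization S.Tr S.Tp Nr Np MO) (hNr : Nr ≠ 0)
    -- the system with disturbance and fault inputs and one output
    {n₂ : ℕ} (S' : FaultSystem n₂) (hS' : IsObservable S'.A S'.C)
    (Nf Nd MI : RatFunc ℝ) (hI : IsLeftCoprimeFactorization S'.Tf S'.Td Nf Nd MI) (hNf : Nf ≠ 0) :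
    -- lower bounds
    hInfNorm (Np / Nr) ^ 2 ≤ S.oog ∧
    4 * hInfNorm (Nd / Nf) ^ 2 ≤ S'.iig ∧
    -- equality over periodic trajectories, with zero and with arbitrary initial state
    ((∀ s : ℂ, 0 < s.re → ¬ IsPole (Np / Nr) s) →
      S.periodicOog {0} = hInfNorm (Np / Nr) ^ 2 ∧
      S.periodicOog Set.univ = hInfNorm (Np / Nr) ^ 2) ∧
    -- equality over periodic trajectories, with zero and with arbitrary reachable initial states
    ((∀ s : ℂ, 0 < s.re → ¬ IsPole (Nd / Nf) s) →
      S'.periodicIig {0} {0} = 4 * hInfNorm (Nd / Nf) ^ 2 ∧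
      ((∀ s : ℂ, s.re = 0 → ¬ (IsZero Nf s ∧ IsZero Nd s)) →
        S'.periodicIig (reachable S'.A S'.Bf) (reachable S'.A S'.Bd) =
          4 * hInfNorm (Nd / Nf) ^ 2)) := by
  obtain ⟨hR, hG⟩ := S.div_eq_of_isRightCoprimeFactorization hO hNr
  obtain ⟨hF, hG'⟩ := S'.div_eq_of_isLeftCoprimeFactorization hI hNf
  have hlow : (∀ s : ℂ, 0 < s.re → ¬ IsPole (Np / Nr) s) →
      hInfNorm (Np / Nr) ^ 2 ≤ S.periodicOog {0} := fun hpole => by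
    simpa using mul_hInfNorm_sq_le hR hG hpole one_pos fun w c hw hc h => by
      simpa using S.le_periodicOog hw hc h
  have hlow' : (∀ s : ℂ, 0 < s.re → ¬ IsPole (Nd / Nf) s) →
      4 * hInfNorm (Nd / Nf) ^ 2 ≤ S'.periodicIig {0} {0} := fun hpole => by
    simpa using mul_hInfNorm_sq_le hF hG' hpole four_pos fun w c hw hc h =>
      S'.le_periodicIig hw hc h
  refine ⟨?_, ?_, fun hpole => ?_, fun hpole => ⟨?_, fun hz => ?_⟩⟩
  -- Without poles the periodic zero-state value is already a lower bound; with a pole the gain is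
  -- infinite.
  · by_cases hpole : ∀ s : ℂ, 0 < s.re → ¬ IsPole (Np / Nr) s
    · exact (hlow hpole).trans S.periodicOog_zero_le_oog
    · push Not at hpole
      obtain ⟨s, hs, hp⟩ := hpole
      rw [S.oog_eq_top hs hR hG hp]
      exact le_top
  · by_cases hpole : ∀ s : ℂ, 0 < s.re → ¬ IsPole (Nd / Nf) s
    · exact (hlow' hpole).trans S'.periodicIig_zero_le_iig
    · push Not at hpole
      obtain ⟨s, hs, hp⟩ := hpole
      rw [S'.iig_eq_top hs hF hG' hp]
      exact le_top
  · exact ⟨(S.periodicOog_le hS hR hG _).antisymm (hlow hpole),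
      (S.periodicOog_le hS hR hG _).antisymm
        ((hlow hpole).trans (S.periodicOog_mono (Set.subset_univ _)))⟩
  · exact (S'.periodicIig_zero_le hI hNf).antisymm (hlow' hpole)
  · exact (S'.periodicIig_reachable_le hI hNf hz).antisymm ((hlow' hpole).trans
      (S'.periodicIig_mono (Set.singleton_subset_iff.2 (zero_mem _))
        (Set.singleton_subset_iff.2 (zero_mem _))))
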